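/- Work over $\mathbb C$ and let $S=\mathbb C[x,y,z,w]$. Let $f\in S$ be homogeneous of degree $d$. * The surface $f=0$ in $\mathbb P^3$ is **homaloidal** if its gradient map $\mathbb P^3\dashrightarrow\mathbb P^3$, $p\mapsto (f_x(p):f_y(p):f_z(p):f_w(p))$, has degree one, i.e. is birational. * Let $AR(f)$ be the graded $S$-module of all $(a_0,a_1,a_2,a_3)\in S^4$ with $a_0f_x+a_1f_y+a_2f_z+a_3f_w=0$. The surface is **free** if $AR(f)$ is a free graded $S$-module of rank 3. It is **nearly free** if, for some integers $1\le d_1\le d_2\le d_3$, the algebra $M(f)=S/(f_x,f_y,f_z,f_w)$ has a minimal graded free resolution $$0\to S(-d-d_3)\to S(-d-d_1+1)\oplus S(-d-d_2+1)\oplus S(-d-d_3+1)^2\to S(-d+1)^4\to S,$$ that is, $AR(f)$ has four homogeneous generators, of degrees $d_1,d_2,d_3,d_3$, whose module of relations is generated by one nonzero homogeneous relation of degree $d_3+1$. * Two surfaces $f=0$ and $g=0$ are **projectively equivalent**, written $\cong$, if some invertible linear change of coordinates takes $f$ to a nonzero constant multiple of $g$. Consider the surfaces $$\Delta_3:\ y^2z^2-4xz^3-4y^3w+18xyzw-27x^2w^2=0,$$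 $$D_d:\ x^{d-1}z+y^d+x^{d-2}yw+x^4y^{d-4}=0\quad(d\ge 4),$$ $$D'_d:\ x^{d-1}z+y^d+x^{d-2}yw+x^{d-5}y^5=0\quad(d\ge 5),$$ $$D''_d:\ x^{d-1}z+y^d+x^{d-2}yw=0\quad(d\ge 4),$$ $$D'''_d:\ x^{d-1}z+y^d+x^{d-2}yw+xy^{d-1}=0\quad(d\ge 5).$$ **Corollary.** The following surfaces are irreducible, of degree $d$ and homaloidal, and they are free or nearly free as indicated. 1. $d=4$: the free surface $\Delta_3$ and the nearly free surface $D_4\cong D''_4$. 2. $d=5$: the nearly free surfaces $D_5\cong D'_5\cong D''_5$ and $D'''_5$. 3. $d=6$: the nearly free surfaces $D_6\cong D''_6$ and $D'_6\cong D'''_6$. 4. $d=7,8$: the free surface $D_d$ and the nearly free surfaces $D'_d$, $D''_d$, $D'''_d$. 5. $d=9$: the nearly free surfaces $D_9\cong D'_9$, $D''_9$ and $D'''_9$. 6. $d\ge 10$: the free surface $D'_d$ and the nearly free surfaces $D_d$, $D''_d$, $D'''_d$. Moreover, for each degree $d$ the surfaces listed as different entries (that is, up to the equivalences $\cong$ indicated)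 are pairwise not projectively equivalent. -/

import Mathlib

open MvPolynomial

namespace SurfP3

/-- The graded ring `ℂ[x, y, z, w]`; the variables `x, y, z, w` are `X 0, X 1, X 2, X 3`. -/
abbrev S : Type := MvPolynomial (Fin 4) ℂ

/-! ### Rational self-maps of projective 3-space and homaloidal surfaces -/

/-- `F` represents a rational map from `ℙ³` to `ℙ³`, `p ↦ (F₀(p) : F₁(p) : F₂(p) : F₃(p))`:
its entries are forms of one common degree, not all of them zero. -/
def IsRationalMap (F : Fin 4 → S) : Prop :=
  F ≠ 0 ∧ ∃ m : ℕ, ∀ i, (F i).IsHomogeneous m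

/-- The composition `G ∘ F`, obtained by substituting the entries of `F` in those of `G`. -/
noncomputable def comp (G F : Fin 4 → S) : Fin 4 → S :=
  fun i => bind₁ F (G i)

/-- The tuple `F` represents the identity rational map of `ℙ³`: it is not zero and it is
proportional to the tuple `(x, y, z, w)`. -/
def IsIdentityMap (F : Fin 4 → S) : Prop :=
  F ≠ 0 ∧ ∀ i j, F i * X j = F j * X i

/-- The rational map `F` is birational: some rational map `G` is its inverse, i.e. both
compositions are defined and equal to the identity. -/
def IsBirational (F : Fin 4 → S) : Prop :=
  IsRationalMap F ∧
    ∃ G : Fin 4 → S, IsRationalMap G ∧ IsIdentityMap (comp G F) ∧ IsIdentityMap (comp F G)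

/-- The gradient `(f_x, f_y, f_z, f_w)`. -/
noncomputable def gradientMap (f : S) : Fin 4 → S :=
  fun i => pderiv i f

/-- The surface `f = 0` is homaloidal: its gradient map is birational. -/
def IsHomaloidal (f : S) : Prop :=
  IsBirational (gradientMap f)

/-- `f = 0` is an irreducible surface of degree `d` in `ℙ³` and it is homaloidal. -/
def IsIrreducibleHomaloidal (d : ℕ) (f : S) : Prop :=
  f.IsHomogeneous d ∧ Irreducible f ∧ IsHomaloidal f

/-! ### Jacobian syzygies, free and nearly free surfaces -/

/-- The graded module of Jacobian syzygies of `f`: all `(a₀, a₁, a₂, a₃)` such that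
`a₀ f_x + a₁ f_y + a₂ f_z + a₃ f_w = 0`. -/
noncomputable def AR (f : S) : Submodule S (Fin 4 → S) :=
  LinearMap.ker (Fintype.linearCombination S (gradientMap f))

/-- A vector of polynomials is homogeneous of degree `k` if all its entries are. -/
def IsHomogeneousVec (k : ℕ) (a : Fin 4 → S) : Prop :=
  ∀ i, (a i).IsHomogeneous k

/-- The surface `f = 0` is free with exponents `e 0 ≤ e 1 ≤ e 2`: the module of Jacobian syzygies
is a free graded module with a basis of homogeneous elements of these degrees. -/
def IsFreeWithExponents (f : S) (e : Fin 3 → ℕ) : Prop :=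
  Monotone e ∧ ∃ b : Module.Basis (Fin 3) S (AR f), ∀ i, IsHomogeneousVec (e i) (b i : Fin 4 → S)

/-- The surface `f = 0` is free. -/
def IsFree (f : S) : Prop :=
  ∃ e : Fin 3 → ℕ, IsFreeWithExponents f e

/-- The surface `f = 0`, of degree `d`, is nearly free with exponents `d₁ ≤ d₂ ≤ d₃`: its Milnor
algebra `M(f) = S / (f_x, f_y, f_z, f_w)` has a minimal graded free resolution
`0 → S(-d-d₃) → S(-d-d₁+1) ⊕ S(-d-d₂+1) ⊕ S(-d-d₃+1)² → S(-d+1)⁴ → S`, `1 ≤ d₁ ≤ d₂ ≤ d₃`.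
In terms of syzygies: `AR f` is generated by four homogeneous elements `ρ i` of degrees
`d₁, d₂, d₃, d₃`, and the module of relations between them is generated by one nonzero relation
`h`, homogeneous of degree `d₃ + 1`. The resolution is minimal since all entries of its matrices
have positive degree. -/
def IsNearlyFreeWithExponents (f : S) (d₁ d₂ d₃ : ℕ) : Prop :=
  1 ≤ d₁ ∧ d₁ ≤ d₂ ∧ d₂ ≤ d₃ ∧
    ∃ ρ : Fin 4 → (Fin 4 → S),
      (∀ i, IsHomogeneousVec (![d₁, d₂, d₃, d₃] i) (ρ i)) ∧
      Submodule.span S (Set.range ρ) = AR f ∧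
      ∃ h : Fin 4 → S,
        (∀ i, (h i).IsHomogeneous (d₃ + 1 - ![d₁, d₂, d₃, d₃] i)) ∧
        h ≠ 0 ∧
        LinearMap.ker (Fintype.linearCombination S ρ) = Submodule.span S {h}

/-- The surface `f = 0` is nearly free. -/
def IsNearlyFree (f : S) : Prop :=
  ∃ d₁ d₂ d₃ : ℕ, IsNearlyFreeWithExponents f d₁ d₂ d₃

/-! ### Projective equivalence -/

/-- The polynomial `f(A · (x, y, z, w)ᵗ)`. -/
noncomputable def linSubst (A : Matrix (Fin 4) (Fin 4) ℂ) (f : S) : S :=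
  bind₁ (fun i => ∑ j, C (A i j) * X j) f

/-- The surfaces `f = 0` and `g = 0` are projectively equivalent: an invertible linear change of
coordinates takes `f` to a nonzero constant multiple of `g`. -/
def ProjEquiv (f g : S) : Prop :=
  ∃ A : GL (Fin 4) ℂ, ∃ c : ℂ, c ≠ 0 ∧ linSubst A f = C c * g

/-! ### The surfaces -/

/-- The discriminant of the binary cubic form `x u³ + y u² v + z u v² + w v³`. -/
noncomputable def Delta3 : S :=
  X 1 ^ 2 * X 2 ^ 2 - 4 * X 0 * X 2 ^ 3 - 4 * X 1 ^ 3 * X 3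
    + 18 * X 0 * X 1 * X 2 * X 3 - 27 * X 0 ^ 2 * X 3 ^ 2

/-- The surface `D_d`, used for `d ≥ 4`. -/
noncomputable def D (d : ℕ) : S :=
  X 0 ^ (d - 1) * X 2 + X 1 ^ d + X 0 ^ (d - 2) * X 1 * X 3 + X 0 ^ 4 * X 1 ^ (d - 4)

/-- The surface `D'_d`, used for `d ≥ 5`. -/
noncomputable def D' (d : ℕ) : S :=
  X 0 ^ (d - 1) * X 2 + X 1 ^ d + X 0 ^ (d - 2) * X 1 * X 3 + X 0 ^ (d - 5) * X 1 ^ 5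

/-- The surface `D''_d`, used for `d ≥ 4`. -/
noncomputable def D'' (d : ℕ) : S :=
  X 0 ^ (d - 1) * X 2 + X 1 ^ d + X 0 ^ (d - 2) * X 1 * X 3

/-- The surface `D'''_d`, used for `d ≥ 5`. -/
noncomputable def D''' (d : ℕ) : S :=
  X 0 ^ (d - 1) * X 2 + X 1 ^ d + X 0 ^ (d - 2) * X 1 * X 3 + X 0 * X 1 ^ (d - 1)

/-- A list of surfaces no two of which are projectively equivalent. -/
def PairwiseInequivalent (L : List S) : Prop :=
  L.Pairwise fun f g => ¬ ProjEquiv f g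

end SurfP3

open SurfP3

/-! Apart from `Delta3`, every surface has the form f = x^(d-1) z + x^(d-2) y w + g(x, y). Its
gradient map can be inverted by hand: f_z : f_w = x : y, after which f_y is linear in w and f_x is
linear in z (`isHomaloidal_ruledSurface`). It is irreducible because it is linear in z, with leading
coefficient a power of x, while x does not divide the rest, g containing y^d.

For the syzygies, (0, 0, y, -x) generates the kernel of the projection of AR(f) to the first two
coordinates, so it suffices to describe the image. When g = y^d + x^k y^(d-k), put κ = k - 1 and m =
d - 1 - k. The image then consists of the pairs (a, x^κ b) with x^m | a P + b Q, for two explicit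
forms P and Q (`PencilData`). This congruence is solved by a Euclidean division of Q by P modulo
x^m, whose course depends on k and m. In the range used here, k ≥ m + 1 gives a free surface with
exponents (1, m, k-1); k = m or k = m - 1 gives a nearly free one with (1, k, m); k ≤ m - 2 gives a
nearly free one with (1, k+1, m-1); without the extra monomial the exponents are (1, 1, d-2). `D`,
`D'`, `D'''` are the cases k = 4, k = d - 5, k = 1, and comparing k with m yields the list.

For `Delta3`, the gradient followed by the SL₂-identification of binary cubics with their duals is
the cubic covariant, an involution up to the factor Δ². The three vector fields of sl₂ together with
the Euler field have determinant 2Δ, so Saito's criterion gives freeness.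

Surfaces are told apart by the set of degrees of minimal generators of AR(f). It is invariant since
n belongs to it exactly when the syzygies of degree n are not all generated in lower degree
(`HasMinimalGenerators.mem_range_iff`). The coincidences in low degrees are equalities of
polynomials or absorb the extra monomial by a triangular change of z and w. -/

namespace SurfP3

/-! ### Homogeneous components of syzygies -/

section Graded

attribute [local instance] MvPolynomial.gradedAlgebra

theorem homogeneousComponent_mul_of_isHomogeneous {p : S} {m : ℕ} (hp : p.IsHomogeneous m)
    (r : S) (n : ℕ) :
    homogeneousComponent n (r * p) =
      (if m ≤ n then homogeneousComponent (n - m) r else 0) * p := by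
  have h := DirectSum.coe_decompose_mul_of_right_mem (homogeneousSubmodule (Fin 4) ℂ) n
    (a := r) (b := p) (i := m) hp
  have key : ∀ (q : S) (k : ℕ), (DirectSum.decompose (homogeneousSubmodule (Fin 4) ℂ) q k : S)
      = homogeneousComponent k q := fun q k => by
    exact decomposition.decompose'_apply q k
  rw [key, key] at h
  rw [h]
  split_ifs <;> simp

end Graded

/-- The homogeneous component of a vector of polynomials. -/
noncomputable def vecComponent (n : ℕ) (a : Fin 4 → S) : Fin 4 → S :=
  fun j => homogeneousComponent n (a j)

theorem isHomogeneousVec_vecComponent (n : ℕ) (a : Fin 4 → S) :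
    IsHomogeneousVec n (vecComponent n a) :=
  fun j => homogeneousComponent_isHomogeneous n (a j)

theorem mem_AR {f : S} {a : Fin 4 → S} :
    a ∈ AR f ↔ a 0 * pderiv 0 f + a 1 * pderiv 1 f + a 2 * pderiv 2 f + a 3 * pderiv 3 f = 0 := by
  simp [AR, LinearMap.mem_ker, Fintype.linearCombination_apply, gradientMap, Fin.sum_univ_four]

theorem vecComponent_mem_AR {f : S} {d : ℕ} (hf : f.IsHomogeneous d) {a : Fin 4 → S}
    (ha : a ∈ AR f) (n : ℕ) : vecComponent n a ∈ AR f := by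
  rw [mem_AR] at ha ⊢
  have h := congrArg (homogeneousComponent (n + (d - 1))) ha
  have hd : ∀ i, (pderiv i f).IsHomogeneous (d - 1) := fun i => hf.pderiv
  simpa [homogeneousComponent_mul_of_isHomogeneous (hd _), vecComponent] using h

/-- A homogeneous combination of homogeneous vectors can be taken with homogeneous
coefficients. -/
theorem exists_homogeneous_coeffs {ι : Type*} [Fintype ι] {ρ : ι → Fin 4 → S} {deg : ι → ℕ}
    (hρ : ∀ i, IsHomogeneousVec (deg i) (ρ i)) {a : Fin 4 → S} {n : ℕ}
    (ha : IsHomogeneousVec n a) {r : ι → S} (hr : ∑ i, r i • ρ i = a) :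
    ∃ r' : ι → S, ∑ i, r' i • ρ i = a ∧ ∀ i, n < deg i → r' i = 0 := by
  refine ⟨fun i => if deg i ≤ n then homogeneousComponent (n - deg i) (r i) else 0, ?_, ?_⟩
  · funext j
    have h := congrArg (fun v => homogeneousComponent n (v j)) hr
    simp only [Finset.sum_apply, Pi.smul_apply, smul_eq_mul, map_sum,
      homogeneousComponent_mul_of_isHomogeneous (hρ _ j),
      homogeneousComponent_eq_self (ha j)] at h ⊢
    exact h
  · intro i hi
    simp [not_le.mpr hi]

/-! ### Minimal systems of generators of the module of syzygies -/

/-- `AR f` has a system of homogeneous generators of degrees `deg i` whose relations have no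
unit among their coefficients. -/
def HasMinimalGenerators (f : S) {ι : Type} [Fintype ι] (deg : ι → ℕ) : Prop :=
  ∃ ρ : ι → Fin 4 → S, (∀ i, IsHomogeneousVec (deg i) (ρ i)) ∧
    (∀ a, a ∈ AR f ↔ ∃ r : ι → S, ∑ i, r i • ρ i = a) ∧
    ∀ r : ι → S, ∑ i, r i • ρ i = 0 → ∀ i, ¬ IsUnit (r i)

/-- The submodule of `AR f` generated by the homogeneous syzygies of degree less than `n`. -/
noncomputable def lowerSyzygies (f : S) (n : ℕ) : Submodule S (Fin 4 → S) :=
  Submodule.span S {a | a ∈ AR f ∧ ∃ m < n, IsHomogeneousVec m a}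

/-- The right-hand side does not mention the generators, which makes the set of degrees an invariant
of `f`. This is graded Nakayama: a generator lying in the span of lower degrees would give a
relation with a unit coefficient. -/
theorem HasMinimalGenerators.mem_range_iff {f : S} {ι : Type} [Fintype ι] {deg : ι → ℕ}
    (h : HasMinimalGenerators f deg) (n : ℕ) :
    n ∈ Set.range deg ↔ ¬ ∀ a ∈ AR f, IsHomogeneousVec n a → a ∈ lowerSyzygies f n := by
  classical
  obtain ⟨ρ, hρ, hgen, hrel⟩ := h
  have hmem : ∀ i, ρ i ∈ AR f := fun i =>
    (hgen _).2 ⟨Pi.single i 1, by simp [Pi.single_apply]⟩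
  constructor
  · rintro ⟨i, rfl⟩ hall
    have hi := hall (ρ i) (hmem i) (hρ i)
    -- The combinations that involve only generators of degree less than `deg i`; in particular `ρ
    -- i` has coefficient zero in them.
    let N : Submodule S (Fin 4 → S) :=
      { carrier := {a | ∃ r : ι → S, ∑ j, r j • ρ j = a ∧ ∀ j, deg i ≤ deg j → r j = 0}
        add_mem' := by
          rintro a b ⟨r, hr, hr'⟩ ⟨s, hs, hs'⟩
          refine ⟨r + s, by simp [add_smul, Finset.sum_add_distrib, hr, hs], ?_⟩
          intro j hj
          simp [hr' j hj, hs' j hj]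
        zero_mem' := ⟨0, by simp, by simp⟩
        smul_mem' := by
          rintro c a ⟨r, hr, hr'⟩
          refine ⟨c • r, by simp [← hr, Finset.smul_sum, mul_smul], ?_⟩
          intro j hj
          simp [hr' j hj] }
    have hle : lowerSyzygies f (deg i) ≤ N := by
      refine Submodule.span_le.2 ?_
      rintro a ⟨ha, m, hm, ham⟩
      obtain ⟨r, hr⟩ := (hgen a).1 ha
      obtain ⟨r', hr', hr0⟩ := exists_homogeneous_coeffs hρ ham hr
      exact ⟨r', hr', fun j hj => hr0 j (by omega)⟩
    obtain ⟨r, hr, hr0⟩ := hle hi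
    -- In this relation the coefficient of `ρ i` is `-1`.
    refine hrel (r - Pi.single i 1) ?_ i ?_
    · simp [sub_smul, hr, Pi.single_apply]
    · simp [hr0 i le_rfl]
  · intro hno
    by_contra hn
    refine hno fun a ha han => ?_
    obtain ⟨r, hr⟩ := (hgen a).1 ha
    obtain ⟨r', hr', hr0⟩ := exists_homogeneous_coeffs hρ han hr
    rw [← hr']
    refine Submodule.sum_mem _ fun i _ => ?_
    rcases lt_trichotomy (deg i) n with hi | hi | hi
    · exact Submodule.smul_mem _ _ (Submodule.subset_span ⟨hmem i, _, hi, hρ i⟩)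
    · exact absurd ⟨i, hi⟩ hn
    · simp [hr0 i hi]

theorem HasMinimalGenerators.range_eq {f : S} {ι κ : Type} [Fintype ι] [Fintype κ]
    {deg : ι → ℕ} {deg' : κ → ℕ} (h : HasMinimalGenerators f deg)
    (h' : HasMinimalGenerators f deg') : Set.range deg = Set.range deg' := by
  ext n
  rw [h.mem_range_iff, h'.mem_range_iff]

theorem IsFreeWithExponents.hasMinimalGenerators {f : S} {e : Fin 3 → ℕ}
    (h : IsFreeWithExponents f e) : HasMinimalGenerators f e := by
  obtain ⟨-, b, hb⟩ := h
  refine ⟨fun i => b i, hb, fun a => ⟨fun ha => ⟨b.repr ⟨a, ha⟩, ?_⟩, ?_⟩, ?_⟩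
  · have hs := congrArg (AR f).subtype (b.sum_repr ⟨a, ha⟩)
    rw [map_sum] at hs
    exact hs
  · rintro ⟨r, rfl⟩
    exact Submodule.sum_mem _ fun i _ => Submodule.smul_mem _ _ (b i).2
  · intro r hr i
    have h0 : ∑ i, r i • b i = 0 := by
      apply Subtype.ext
      simpa using hr
    have := Fintype.linearIndependent_iff.1 b.linearIndependent r h0 i
    simp [this]

theorem not_isUnit_of_isHomogeneous {p : S} {n : ℕ} (hp : p.IsHomogeneous n) (hn : n ≠ 0) :
    ¬ IsUnit p := by
  intro hu
  have h0 : constantCoeff p = 0 := by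
    rw [constantCoeff_eq]
    exact hp.coeff_eq_zero (by simpa using hn.symm)
  have := hu.map (constantCoeff (R := ℂ) (σ := Fin 4))
  simp [h0] at this

theorem IsNearlyFreeWithExponents.hasMinimalGenerators {f : S} {d₁ d₂ d₃ : ℕ}
    (h : IsNearlyFreeWithExponents f d₁ d₂ d₃) :
    HasMinimalGenerators f ![d₁, d₂, d₃, d₃] := by
  obtain ⟨h1, h12, h23, ρ, hρ, hspan, k, hk, -, hker⟩ := h
  have hdeg : ∀ i, d₃ + 1 - ![d₁, d₂, d₃, d₃] i ≠ 0 := by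
    intro i
    fin_cases i <;> simp <;> omega
  refine ⟨ρ, hρ, fun a => ?_, fun r hr i hu => ?_⟩
  · rw [← hspan, Submodule.mem_span_range_iff_exists_fun]
  · have : r ∈ LinearMap.ker (Fintype.linearCombination S ρ) := by
      simpa [Fintype.linearCombination_apply] using hr
    rw [hker, Submodule.mem_span_singleton] at this
    obtain ⟨t, ht⟩ := this
    have hti : r i = t * k i := (congrFun ht i).symm
    rw [hti] at hu
    exact not_isUnit_of_isHomogeneous (hk i) (hdeg i) (isUnit_of_mul_isUnit_right hu)

/-! ### Projective equivalence and syzygies -/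

theorem pderiv_bind₁ (g : Fin 4 → S) (f : S) (j : Fin 4) :
    pderiv j (bind₁ g f) = ∑ i, bind₁ g (pderiv i f) * pderiv j (g i) := by
  induction f using MvPolynomial.induction_on with
  | C a => simp
  | add p q hp hq => simp [hp, hq, add_mul, Finset.sum_add_distrib]
  | mul_X p n hp =>
    have h1 : ∀ i, bind₁ g (pderiv i (p * X n)) * pderiv j (g i) =
        bind₁ g (pderiv i p) * pderiv j (g i) * g n +
          if i = n then bind₁ g p * pderiv j (g n) else 0 := by
      intro i
      rw [pderiv_mul, map_add, map_mul, map_mul, bind₁_X_right]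
      split_ifs with h
      · subst h
        rw [pderiv_X_self, map_one]
        ring
      · rw [pderiv_X_of_ne (Ne.symm h), map_zero]
        ring
    rw [Finset.sum_congr rfl fun i _ => h1 i, Finset.sum_add_distrib, ← Finset.sum_mul, ← hp,
      Finset.sum_ite_eq' Finset.univ n, if_pos (Finset.mem_univ n), map_mul, bind₁_X_right,
      pderiv_mul]

theorem bind₁_linear_linear (A B : Matrix (Fin 4) (Fin 4) ℂ) (f : S) :
    linSubst A (linSubst B f) = linSubst (B * A) f := by
  unfold linSubst
  rw [bind₁_bind₁]
  congr 1
  congr 1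
  funext i
  simp only [map_sum, map_mul, bind₁_C_right, bind₁_X_right, Matrix.mul_apply, Finset.mul_sum,
    Finset.sum_mul]
  rw [Finset.sum_comm]
  simp [mul_assoc]

theorem linSubst_C_mul (A : Matrix (Fin 4) (Fin 4) ℂ) (c : ℂ) (f : S) :
    linSubst A (C c * f) = C c * linSubst A f := by
  simp [linSubst]

theorem linSubst_one (f : S) : linSubst 1 f = f := by
  have : (fun i => ∑ j, C ((1 : Matrix (Fin 4) (Fin 4) ℂ) i j) * X j : Fin 4 → S) = X := by
    funext i
    simp [Matrix.one_apply]
  rw [linSubst, this, bind₁_X_left]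
  rfl

/-- The linear change of coordinates with invertible matrix, as an automorphism. -/
noncomputable def linEquiv (A : GL (Fin 4) ℂ) : S ≃ₐ[ℂ] S :=
  AlgEquiv.ofAlgHom (bind₁ (fun i => ∑ j, C (A.1 i j) * X j))
    (bind₁ (fun i => ∑ j, C (A⁻¹.1 i j) * X j))
    (AlgHom.ext fun f => by
      have := bind₁_linear_linear A.1 A⁻¹.1 f
      rw [← Units.val_mul, inv_mul_cancel, Units.val_one, linSubst_one] at this
      exact this)
    (AlgHom.ext fun f => by
      have := bind₁_linear_linear A⁻¹.1 A.1 f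
      rw [← Units.val_mul, mul_inv_cancel, Units.val_one, linSubst_one] at this
      exact this)

theorem isHomogeneous_linSubst (A : Matrix (Fin 4) (Fin 4) ℂ) {f : S} {n : ℕ}
    (hf : f.IsHomogeneous n) : (linSubst A f).IsHomogeneous n := by
  have := hf.aeval (fun i => ∑ j, C (A i j) * X j : Fin 4 → S) (n := 1)
    (fun i => IsHomogeneous.sum _ _ _ fun j _ => isHomogeneous_C_mul_X _ _)
  rw [one_mul] at this
  exact this

theorem AR_C_mul {c : ℂ} (hc : c ≠ 0) (f : S) : AR (C c * f) = AR f := by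
  ext a
  rw [mem_AR, mem_AR]
  simp only [pderiv_C_mul]
  have : (C c : S) ≠ 0 := by simpa using hc
  constructor
  · intro h
    apply mul_left_cancel₀ this
    linear_combination h
  · intro h
    linear_combination C c * h

/-- A projective equivalence identifies the modules of syzygies, semilinearly and respecting
degrees. -/
theorem ProjEquiv.exists_semilinear {f g : S} (h : ProjEquiv f g) :
    ∃ (ψ : S ≃ₐ[ℂ] S) (τ : (Fin 4 → S) ≃+ (Fin 4 → S)),
      (∀ r a, τ (r • a) = ψ r • τ a) ∧
      (∀ n p, p.IsHomogeneous n → (ψ.symm p).IsHomogeneous n) ∧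
      (∀ n a, IsHomogeneousVec n a → IsHomogeneousVec n (τ.symm a)) ∧
      ∀ a, a ∈ AR g ↔ τ a ∈ AR f := by
  obtain ⟨A, c, hc, hfg⟩ := h
  let M : Matrix (Fin 4) (Fin 4) ℂ → (Fin 4 → S) →ₗ[S] (Fin 4 → S) := fun B =>
    Matrix.mulVecLin (B.map C)
  have hMM : ∀ B B' : Matrix (Fin 4) (Fin 4) ℂ, ∀ a, M B (M B' a) = M (B * B') a := by
    intro B B' a
    simp only [M, Matrix.mulVecLin_apply, Matrix.mulVec_mulVec]
    rw [Matrix.map_mul]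
  have hM1 : ∀ a, M 1 a = a := by
    intro a
    simp only [M, Matrix.mulVecLin_apply]
    rw [Matrix.map_one _ C_0 C_1, Matrix.one_mulVec]
  let φ := linEquiv A
  -- By the chain rule the gradient of f ∘ A is the transpose of A applied to (∇f) ∘ A. Hence a is a
  -- syzygy of f ∘ A exactly when A a, with the substitution undone in its entries, is a syzygy of
  -- f.
  let τ : (Fin 4 → S) ≃+ (Fin 4 → S) :=
    { toFun := fun a i => φ.symm (M A.1 a i)
      invFun := fun b => M A⁻¹.1 (fun i => φ (b i))
      left_inv := by
        intro a
        simp only [AlgEquiv.apply_symm_apply]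
        rw [hMM, ← Units.val_mul, inv_mul_cancel, Units.val_one, hM1]
      right_inv := by
        intro b
        dsimp only
        rw [hMM, ← Units.val_mul, mul_inv_cancel, Units.val_one, hM1]
        simp
      map_add' := by
        intro a b
        funext i
        simp }
  refine ⟨φ.symm, τ, ?_, ?_, ?_, ?_⟩
  · intro r a
    funext i
    simp [τ]
  · intro n p hp
    exact isHomogeneous_linSubst _ hp
  · intro n a ha i
    change ((Matrix.map A⁻¹.1 C).mulVec (fun i => φ (a i)) i).IsHomogeneous n
    simp only [Matrix.mulVec, dotProduct, Matrix.map_apply]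
    exact IsHomogeneous.sum _ _ _ fun j _ => (isHomogeneous_linSubst _ (ha j)).C_mul _
  · intro a
    rw [← AR_C_mul hc g, ← hfg, mem_AR]
    have hd : ∀ j, pderiv j (linSubst A.1 f) = ∑ i, φ (pderiv i f) * C (A.1 i j) := by
      intro j
      rw [linSubst, pderiv_bind₁]
      refine Finset.sum_congr rfl fun i _ => ?_
      congr 1
      simp [pderiv_X, Pi.single_apply]
    have key : a 0 * pderiv 0 (linSubst A.1 f) + a 1 * pderiv 1 (linSubst A.1 f)
        + a 2 * pderiv 2 (linSubst A.1 f) + a 3 * pderiv 3 (linSubst A.1 f)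
        = φ (τ a 0 * pderiv 0 f + τ a 1 * pderiv 1 f + τ a 2 * pderiv 2 f
          + τ a 3 * pderiv 3 f) := by
      have ht : ∀ i, φ (τ a i) = ∑ j, C (A.1 i j) * a j := by
        intro i
        change φ (φ.symm (M A.1 a i)) = _
        rw [AlgEquiv.apply_symm_apply]
        simp [M, Matrix.mulVec, dotProduct]
      simp only [map_add, map_mul, ht, hd, Fin.sum_univ_four]
      ring
    rw [key, mem_AR, map_eq_zero_iff _ φ.injective]

theorem ProjEquiv.exists_generators {f g : S} (h : ProjEquiv f g) :
    ∃ ψ : S ≃ₐ[ℂ] S, (∀ n p, p.IsHomogeneous n → (ψ.symm p).IsHomogeneous n) ∧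
      ∀ {ι : Type} [Fintype ι] (deg : ι → ℕ) (ρ : ι → Fin 4 → S),
        (∀ i, IsHomogeneousVec (deg i) (ρ i)) →
        (∀ a, a ∈ AR f ↔ ∃ r : ι → S, ∑ i, r i • ρ i = a) →
        ∃ ρ' : ι → Fin 4 → S, (∀ i, IsHomogeneousVec (deg i) (ρ' i)) ∧
          (∀ a, a ∈ AR g ↔ ∃ r : ι → S, ∑ i, r i • ρ' i = a) ∧
          ∀ r : ι → S, ∑ i, r i • ρ' i = 0 ↔ ∑ i, ψ (r i) • ρ i = 0 := by
  obtain ⟨ψ, τ, hτ, hψ, hhom, hmem⟩ := h.exists_semilinear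
  refine ⟨ψ, hψ, fun {ι} _ deg ρ hρ hgen => ⟨fun i => τ.symm (ρ i), fun i => hhom _ _ (hρ i),
    fun a => ?_, fun r => ?_⟩⟩
  · rw [hmem, hgen]
    constructor
    · rintro ⟨r, hr⟩
      refine ⟨fun i => ψ.symm (r i), τ.injective ?_⟩
      simp [hτ, hr]
    · rintro ⟨r, rfl⟩
      exact ⟨fun i => ψ (r i), by simp [hτ]⟩
  · rw [← map_eq_zero_iff τ τ.injective]
    simp [hτ]

theorem HasMinimalGenerators.of_projEquiv {f g : S} {ι : Type} [Fintype ι] {deg : ι → ℕ}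
    (hf : HasMinimalGenerators f deg) (h : ProjEquiv f g) : HasMinimalGenerators g deg := by
  obtain ⟨ρ, hρ, hgen, hrel⟩ := hf
  obtain ⟨ψ, -, hψ⟩ := h.exists_generators
  obtain ⟨ρ', h1, h2, h3⟩ := hψ deg ρ hρ hgen
  refine ⟨ρ', h1, h2, fun r hr i hu => ?_⟩
  exact hrel _ ((h3 r).1 hr) i (hu.map ψ)

theorem not_projEquiv_of_range_ne {f g : S} {ι κ : Type} [Fintype ι] [Fintype κ]
    {deg : ι → ℕ} {deg' : κ → ℕ} (hf : HasMinimalGenerators f deg)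
    (hg : HasMinimalGenerators g deg') (hne : Set.range deg ≠ Set.range deg') :
    ¬ ProjEquiv f g :=
  fun h => hne ((hf.of_projEquiv h).range_eq hg)

theorem IsNearlyFreeWithExponents.of_projEquiv {f g : S} {d₁ d₂ d₃ : ℕ}
    (hf : IsNearlyFreeWithExponents f d₁ d₂ d₃) (h : ProjEquiv f g) :
    IsNearlyFreeWithExponents g d₁ d₂ d₃ := by
  obtain ⟨h1, h12, h23, ρ, hρ, hspan, k, hk, hk0, hker⟩ := hf
  obtain ⟨ψ, hψ1, hψ⟩ := h.exists_generators
  obtain ⟨ρ', e1, e2, e3⟩ := hψ _ ρ hρ (fun a => by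
    rw [← hspan, Submodule.mem_span_range_iff_exists_fun])
  refine ⟨h1, h12, h23, ρ', e1, ?_, fun i => ψ.symm (k i), fun i => hψ1 _ _ (hk i), ?_, ?_⟩
  · ext a
    rw [e2, Submodule.mem_span_range_iff_exists_fun]
  · intro h0
    apply hk0
    funext i
    simpa using congrFun h0 i
  · ext r
    rw [LinearMap.mem_ker, Fintype.linearCombination_apply, e3, Submodule.mem_span_singleton]
    have : (∑ i, ψ (r i) • ρ i = 0) ↔ (fun i => ψ (r i)) ∈
        LinearMap.ker (Fintype.linearCombination S ρ) := by
      rw [LinearMap.mem_ker, Fintype.linearCombination_apply]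
    rw [this, hker, Submodule.mem_span_singleton]
    constructor
    · rintro ⟨t, ht⟩
      refine ⟨ψ.symm t, funext fun i => ψ.injective ?_⟩
      simpa using congrFun ht i
    · rintro ⟨t, rfl⟩
      exact ⟨ψ t, funext fun i => by simp⟩

theorem ProjEquiv.symm {f g : S} (h : ProjEquiv f g) : ProjEquiv g f := by
  obtain ⟨A, c, hc, hfg⟩ := h
  refine ⟨A⁻¹, c⁻¹, inv_ne_zero hc, ?_⟩
  have h2 := congrArg (linSubst A⁻¹.1) hfg
  rw [bind₁_linear_linear, ← Units.val_mul, mul_inv_cancel, Units.val_one, linSubst_one] at h2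
  rw [h2, linSubst_C_mul, ← mul_assoc, ← C_mul, inv_mul_cancel₀ hc, C_1, one_mul]

end SurfP3

namespace SurfP3

/-! ### Surfaces with `f_z = x ^ (N + 1)` and `f_w = x ^ N * y` -/

theorem exists_eq_of_mul_X_add_mul_X_eq_zero {c e : S} (h : c * X 0 + e * X 1 = 0) :
    ∃ t : S, c = t * X 1 ∧ e = -(t * X 0) := by
  have h1 : (X 1 : S) ∣ c * X 0 := ⟨-e, by linear_combination h⟩
  have h2 : (X 1 : S) ∣ c := by
    refine ((X_prime (R := ℂ) (i := (1 : Fin 4))).dvd_or_dvd h1).resolve_right ?_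
    rw [X_dvd_X]
    decide
  obtain ⟨t, ht⟩ := h2
  refine ⟨t, by rw [ht]; ring, ?_⟩
  apply mul_right_cancel₀ (X_ne_zero (R := ℂ) (1 : Fin 4))
  rw [ht] at h
  linear_combination h

theorem trivialSyzygy_mem {f : S} {N : ℕ} (hz : pderiv 2 f = X 0 ^ (N + 1))
    (hw : pderiv 3 f = X 0 ^ N * X 1) (t : S) : ![0, 0, t * X 1, -(t * X 0)] ∈ AR f := by
  rw [mem_AR]
  simp [hz, hw]
  ring

/-- The kernel of the projection to the first two coordinates: after cancelling x^N only the Koszul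
relation between x and y remains. -/
theorem eq_trivialSyzygy {f : S} {N : ℕ} (hz : pderiv 2 f = X 0 ^ (N + 1))
    (hw : pderiv 3 f = X 0 ^ N * X 1) {v : Fin 4 → S} (hv : v ∈ AR f) (h0 : v 0 = 0)
    (h1 : v 1 = 0) : ∃ t : S, v = t • ![0, 0, X 1, -X 0] := by
  rw [mem_AR, hz, hw, h0, h1] at hv
  have : (v 2 * X 0 + v 3 * X 1) = 0 := by
    apply mul_left_cancel₀ (pow_ne_zero N (X_ne_zero (R := ℂ) (0 : Fin 4)))
    linear_combination hv
  obtain ⟨t, h2, h3⟩ := exists_eq_of_mul_X_add_mul_X_eq_zero this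
  refine ⟨t, ?_⟩
  funext i
  fin_cases i
  · simp [h0]
  · simp [h1]
  · simp [h2]
  · simp [h3]

/-- Syzygies are lifted from their first two coordinates. -/
theorem exists_homogeneous_lift {f : S} {d n : ℕ} (hf : f.IsHomogeneous d) {a b : S}
    (ha : a.IsHomogeneous n) (hb : b.IsHomogeneous n)
    (h : ∃ c e : S, ![a, b, c, e] ∈ AR f) :
    ∃ v ∈ AR f, IsHomogeneousVec n v ∧ v 0 = a ∧ v 1 = b := by
  obtain ⟨c, e, hv⟩ := h
  refine ⟨_, vecComponent_mem_AR hf hv n, isHomogeneousVec_vecComponent n _, ?_, ?_⟩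
  · exact homogeneousComponent_eq_self ha
  · exact homogeneousComponent_eq_self hb

theorem isHomogeneousVec_trivialSyzygy :
    IsHomogeneousVec 1 (![0, 0, X 1, -X 0] : Fin 4 → S) := by
  intro i
  fin_cases i
  · exact isHomogeneous_zero _ _ _
  · exact isHomogeneous_zero _ _ _
  · exact isHomogeneous_X _ _
  · exact (isHomogeneous_X _ _).neg

/-- AR(f) is an extension of its image in S² by the free module on the trivial syzygy τ. Lifts of
the generators of the image together with τ generate AR(f), and the relation `h` of the image lifts
to a unique relation, its coefficient at τ being forced. -/
theorem isNearlyFree_of_projection {f : S} {d N d₂ d₃ : ℕ} (hf : f.IsHomogeneous d)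
    (hz : pderiv 2 f = X 0 ^ (N + 1)) (hw : pderiv 3 f = X 0 ^ N * X 1)
    (hd₂ : 1 ≤ d₂) (hd₃ : d₂ ≤ d₃) (a b : Fin 3 → S)
    (ha : ∀ i, (a i).IsHomogeneous (![d₂, d₃, d₃] i))
    (hb : ∀ i, (b i).IsHomogeneous (![d₂, d₃, d₃] i))
    (hlift : ∀ i, ∃ c e : S, ![a i, b i, c, e] ∈ AR f)
    (hgen : ∀ v ∈ AR f, ∃ r : Fin 3 → S, v 0 = ∑ i, r i * a i ∧ v 1 = ∑ i, r i * b i)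
    (h : Fin 3 → S) (hh : ∀ i, (h i).IsHomogeneous (d₃ + 1 - ![d₂, d₃, d₃] i)) (hh0 : h ≠ 0)
    (hha : ∑ i, h i * a i = 0) (hhb : ∑ i, h i * b i = 0)
    (hrel : ∀ r : Fin 3 → S, ∑ i, r i * a i = 0 → ∑ i, r i * b i = 0 → ∃ t : S, r = t • h) :
    IsNearlyFreeWithExponents f 1 d₂ d₃ := by
  choose v hv hvh hv0 hv1 using fun i => exists_homogeneous_lift hf (ha i) (hb i) (hlift i)
  set τ : Fin 4 → S := ![0, 0, X 1, -X 0] with hτ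
  have hτmem : τ ∈ AR f := by
    have := trivialSyzygy_mem hz hw 1
    simpa [hτ] using this
  have hle : ∀ i, ![d₂, d₃, d₃] i ≤ d₃ := by
    intro i
    fin_cases i <;> simp [hd₃]
  have hrelvec : ∑ i, h i • v i ∈ AR f :=
    Submodule.sum_mem _ fun i _ => Submodule.smul_mem _ _ (hv i)
  have hhom : IsHomogeneousVec (d₃ + 1) (∑ i, h i • v i) := by
    intro j
    rw [Finset.sum_apply]
    refine IsHomogeneous.sum _ _ _ fun i _ => ?_
    have := (hh i).mul (hvh i j)
    rwa [Nat.sub_add_cancel (by have := hle i; omega)] at this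
  obtain ⟨s, hs⟩ := eq_trivialSyzygy hz hw hrelvec
    (by simpa [hv0] using hha) (by simpa [hv1] using hhb)
  -- The left side has degree `d₃ + 1` and τ has degree 1, so only the component of `s` in degree
  -- `d₃` contributes.
  have hs' : ∑ i, h i • v i = homogeneousComponent d₃ s • τ := by
    have hsc : ∑ i, h i • v i = vecComponent (d₃ + 1) (∑ i, h i • v i) := by
      funext j
      exact (homogeneousComponent_eq_self (hhom j)).symm
    rw [hsc, hs]
    funext j
    simp only [vecComponent, Pi.smul_apply, smul_eq_mul]
    rw [homogeneousComponent_mul_of_isHomogeneous (isHomogeneousVec_trivialSyzygy j)]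
    simp [hτ]
  refine ⟨le_rfl, hd₂, hd₃, Fin.cons τ v, ?_, ?_,
    Fin.cons (-homogeneousComponent d₃ s) h, ?_, ?_, ?_⟩
  · intro i
    refine Fin.cases ?_ (fun i => ?_) i
    · exact isHomogeneousVec_trivialSyzygy
    · simpa using hvh i
  · apply le_antisymm
    · rw [Submodule.span_le]
      rintro _ ⟨i, rfl⟩
      refine Fin.cases ?_ (fun i => ?_) i
      · exact hτmem
      · exact hv i
    · intro u hu
      obtain ⟨r, hr0, hr1⟩ := hgen u hu
      have hsub : u - ∑ i, r i • v i ∈ AR f :=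
        Submodule.sub_mem _ hu (Submodule.sum_mem _ fun i _ => Submodule.smul_mem _ _ (hv i))
      obtain ⟨t, ht⟩ := eq_trivialSyzygy hz hw hsub
        (by simp [hv0, hr0]) (by simp [hv1, hr1])
      rw [Submodule.mem_span_range_iff_exists_fun]
      refine ⟨Fin.cons t r, ?_⟩
      rw [Fin.sum_univ_succ]
      simp only [Fin.cons_zero, Fin.cons_succ]
      rw [← ht]
      simp
  · intro i
    refine Fin.cases ?_ (fun i => ?_) i
    · simpa using (homogeneousComponent_isHomogeneous d₃ s).neg
    · simpa using hh i
  · intro h0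
    apply hh0
    funext i
    simpa using congrFun h0 i.succ
  · ext r
    rw [LinearMap.mem_ker, Fintype.linearCombination_apply, Submodule.mem_span_singleton,
      Fin.sum_univ_succ]
    simp only [Fin.cons_zero, Fin.cons_succ]
    constructor
    · intro hr
      have c0 := congrFun hr 0
      have c1 := congrFun hr 1
      simp only [hτ, Pi.add_apply, Pi.smul_apply, Finset.sum_apply, smul_eq_mul, hv0, hv1,
        Matrix.cons_val_zero, Matrix.cons_val_one, mul_zero, zero_add, Pi.zero_apply] at c0 c1
      obtain ⟨t, ht⟩ := hrel (fun i => r i.succ) c0 c1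
      refine ⟨t, ?_⟩
      have htail : ∀ i, r (Fin.succ i) = t * h i := fun i => congrFun ht i
      have h0 : (r 0 + t * homogeneousComponent d₃ s) • τ = 0 := by
        rw [add_smul, mul_smul, ← hs', Finset.smul_sum]
        simp only [smul_smul, ← htail]
        exact hr
      have h02 := congrFun h0 2
      simp only [hτ, Pi.smul_apply, smul_eq_mul, Pi.zero_apply] at h02
      have hr0 : r 0 + t * homogeneousComponent d₃ s = 0 := by
        rcases mul_eq_zero.1 h02 with h | h
        · exact h
        · exact absurd h (by simp)
      funext i
      refine Fin.cases ?_ (fun i => ?_) i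
      · simp only [Pi.smul_apply, Fin.cons_zero, smul_eq_mul]
        linear_combination -hr0
      · simp [htail]
    · rintro ⟨t, rfl⟩
      simp only [Pi.smul_apply, Fin.cons_zero, Fin.cons_succ, smul_eq_mul, mul_smul]
      rw [← Finset.smul_sum, hs']
      simp

theorem isFree_of_projection {f : S} {d N d₂ d₃ : ℕ} (hf : f.IsHomogeneous d)
    (hz : pderiv 2 f = X 0 ^ (N + 1)) (hw : pderiv 3 f = X 0 ^ N * X 1)
    (hd₂ : 1 ≤ d₂) (hd₃ : d₂ ≤ d₃) (a b : Fin 2 → S)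
    (ha : ∀ i, (a i).IsHomogeneous (![d₂, d₃] i))
    (hb : ∀ i, (b i).IsHomogeneous (![d₂, d₃] i))
    (hlift : ∀ i, ∃ c e : S, ![a i, b i, c, e] ∈ AR f)
    (hgen : ∀ v ∈ AR f, ∃ r : Fin 2 → S, v 0 = ∑ i, r i * a i ∧ v 1 = ∑ i, r i * b i)
    (hrel : ∀ r : Fin 2 → S, ∑ i, r i * a i = 0 → ∑ i, r i * b i = 0 → r = 0) :
    IsFreeWithExponents f ![1, d₂, d₃] := by
  choose v hv hvh hv0 hv1 using fun i => exists_homogeneous_lift hf (ha i) (hb i) (hlift i)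
  set τ : Fin 4 → S := ![0, 0, X 1, -X 0] with hτ
  have hτmem : τ ∈ AR f := by
    have := trivialSyzygy_mem hz hw 1
    simpa [hτ] using this
  let ρ : Fin 3 → AR f := Fin.cons ⟨τ, hτmem⟩ fun i => ⟨v i, hv i⟩
  have hli : LinearIndependent S ρ := by
    rw [Fintype.linearIndependent_iff]
    intro r hr
    have hr' := congrArg (AR f).subtype hr
    rw [map_sum, Fin.sum_univ_succ] at hr'
    simp only [ρ, map_smul, Fin.cons_zero, Fin.cons_succ, Submodule.subtype_apply, map_zero] at hr'
    have c0 := congrFun hr' 0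
    have c1 := congrFun hr' 1
    have c2 := congrFun hr' 2
    simp only [hτ, Pi.add_apply, Pi.smul_apply, Finset.sum_apply, smul_eq_mul, hv0, hv1,
      Matrix.cons_val_zero, Matrix.cons_val_one, mul_zero, zero_add, Pi.zero_apply] at c0 c1
    have htail := hrel (fun i => r i.succ) c0 c1
    have hts : ∀ i : Fin 2, r i.succ = 0 := fun i => congrFun htail i
    have hX : (X 1 : S) ≠ 0 := X_ne_zero _
    have h0 : r 0 = 0 := by
      simpa [hτ, hts, hX] using c2
    intro i
    exact Fin.cases h0 hts i
  have hspan : ⊤ ≤ Submodule.span S (Set.range ρ) := by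
    rintro ⟨u, hu⟩ -
    obtain ⟨r, hr0, hr1⟩ := hgen u hu
    have hsub : u - ∑ i, r i • v i ∈ AR f :=
      Submodule.sub_mem _ hu (Submodule.sum_mem _ fun i _ => Submodule.smul_mem _ _ (hv i))
    obtain ⟨t, ht⟩ := eq_trivialSyzygy hz hw hsub
      (by simp [hv0, hr0]) (by simp [hv1, hr1])
    rw [Submodule.mem_span_range_iff_exists_fun]
    refine ⟨Fin.cons t r, ?_⟩
    apply (AR f).subtype_injective
    rw [map_sum, Fin.sum_univ_succ]
    simp only [ρ, map_smul, Fin.cons_zero, Fin.cons_succ, Submodule.subtype_apply]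
    rw [← ht]
    simp
  refine ⟨?_, Module.Basis.mk hli hspan, ?_⟩
  · rw [Fin.monotone_iff_le_succ]
    intro i
    fin_cases i
    · exact hd₂
    · exact hd₃
  · intro i
    rw [Module.Basis.mk_apply]
    refine Fin.cases ?_ (fun i => ?_) i
    · exact isHomogeneousVec_trivialSyzygy
    · simpa [ρ] using hvh i

/-! ### The first two coordinates of a syzygy -/

/-- Evaluation at `x = 0`. -/
noncomputable def evalXZero : S →ₐ[ℂ] S := aeval ![0, X 1, X 2, X 3]

theorem X_zero_dvd_sub_evalXZero (p : S) : (X 0 : S) ∣ p - evalXZero p := by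
  induction p using MvPolynomial.induction_on with
  | C a => simp [evalXZero, algebraMap_eq]
  | add p q hp hq =>
    rw [map_add, add_sub_add_comm]
    exact dvd_add hp hq
  | mul_X p n hp =>
    have : p * X n - evalXZero (p * X n)
        = (p - evalXZero p) * X n + evalXZero p * (X n - evalXZero (X n)) := by
      rw [map_mul]
      ring
    rw [this]
    refine dvd_add (hp.mul_right _) (Dvd.dvd.mul_left ?_ _)
    fin_cases n <;> simp [evalXZero]

theorem X_zero_dvd_iff {p : S} : (X 0 : S) ∣ p ↔ evalXZero p = 0 := by
  constructor
  · rintro ⟨q, rfl⟩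
    simp [evalXZero]
  · intro h
    simpa [h] using X_zero_dvd_sub_evalXZero p

theorem prime_X_zero : Prime (X 0 : S) := X_prime

theorem pow_X_zero_dvd_of_dvd_mul {n : ℕ} {p q : S} (h : X 0 ^ n ∣ p * q)
    (hq : ¬ (X 0 : S) ∣ q) : X 0 ^ n ∣ p :=
  prime_X_zero.pow_dvd_of_dvd_mul_right n hq h

theorem natCast_ne_zero {n : ℕ} (hn : n ≠ 0) : (n : S) ≠ 0 := by
  exact_mod_cast hn

theorem isUnit_natCast {n : ℕ} (hn : n ≠ 0) : IsUnit (n : S) := by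
  have : IsUnit ((n : ℂ)) := by
    rw [isUnit_iff_ne_zero]
    exact_mod_cast hn
  have h := this.map (C (σ := Fin 4) (R := ℂ))
  simpa using h

/-- The derivatives of a surface of the form `x ^ (N + 1) z + x ^ N y w + g(x, y)`, with the
parts of `f_x` and `f_y` divisible by `y` in the form needed to compute syzygies. -/
structure PencilData (f : S) (κ m : ℕ) (P Q : S) : Prop where
  homogeneous : f.IsHomogeneous (κ + m + 2)
  dx : pderiv 0 f = ((κ + m + 1 : ℕ) : S) * X 0 ^ (κ + m) * X 2 + X 1 * X 0 ^ κ * P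
  dy : pderiv 1 f = X 0 ^ (κ + m) * X 3 + X 1 * Q
  dz : pderiv 2 f = X 0 ^ (κ + m + 1)
  dw : pderiv 3 f = X 0 ^ (κ + m) * X 1
  not_dvd : ¬ (X 0 : S) ∣ Q

variable {f : S} {κ m : ℕ} {P Q : S}

theorem not_X_zero_dvd_X_one : ¬ (X 0 : S) ∣ X 1 := by
  rw [X_dvd_X]
  decide

/-- Modulo x^κ the syzygy equation reduces to v₁ y Q ≡ 0, and x divides neither y nor Q. Once x^κ is
cancelled, the equation modulo x^m gives the second divisibility. -/
theorem PencilData.dvd_of_mem (h : PencilData f κ m P Q) {v : Fin 4 → S} (hv : v ∈ AR f) :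
    ∃ b : S, v 1 = X 0 ^ κ * b ∧ X 0 ^ m ∣ v 0 * P + b * Q := by
  rw [mem_AR, h.dx, h.dy, h.dz, h.dw] at hv
  have h1 : X 0 ^ κ ∣ v 1 := by
    refine pow_X_zero_dvd_of_dvd_mul (q := X 1 * Q) ?_ ?_
    · refine ⟨-(v 0 * (((κ + m + 1 : ℕ) : S) * X 0 ^ m * X 2 + X 1 * P) + v 1 * X 0 ^ m * X 3
        + v 2 * X 0 ^ (m + 1) + v 3 * X 0 ^ m * X 1), ?_⟩
      rw [pow_add, pow_succ, pow_add] at hv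
      rw [pow_succ]
      linear_combination hv
    · exact prime_X_zero.not_dvd_mul not_X_zero_dvd_X_one h.not_dvd
  obtain ⟨b, hb⟩ := h1
  refine ⟨b, hb, pow_X_zero_dvd_of_dvd_mul (q := X 1) ?_ not_X_zero_dvd_X_one⟩
  refine ⟨-(((κ + m + 1 : ℕ) : S) * X 2 * v 0 + X 0 ^ κ * b * X 3 + v 2 * X 0 + v 3 * X 1), ?_⟩
  apply mul_left_cancel₀ (pow_ne_zero κ (X_ne_zero (R := ℂ) (0 : Fin 4)))
  rw [hb, pow_succ, pow_add] at hv
  linear_combination hv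

/-- The terms of f_x and f_y containing z and w are multiples of x^(κ+m), whereas f_z and f_w
generate only x^(κ+m)·(x, y). They can therefore be cancelled when both first coordinates lie in the
ideal (x, y). -/
theorem PencilData.exists_lift (h : PencilData f κ m P Q) {a b : S}
    (hab : X 0 ^ m ∣ a * P + b * Q) (ha : ∃ a₁ a₂, a = X 0 * a₁ + X 1 * a₂)
    (hb : ∃ b₁ b₂, X 0 ^ κ * b = X 0 * b₁ + X 1 * b₂) :
    ∃ c e : S, ![a, X 0 ^ κ * b, c, e] ∈ AR f := by
  obtain ⟨q, hq⟩ := hab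
  obtain ⟨a₁, a₂, ha⟩ := ha
  obtain ⟨b₁, b₂, hb⟩ := hb
  refine ⟨-(((κ + m + 1 : ℕ) : S) * X 2 * a₁ + X 3 * b₁),
    -(((κ + m + 1 : ℕ) : S) * X 2 * a₂ + X 3 * b₂ + q), ?_⟩
  rw [mem_AR, h.dx, h.dy, h.dz, h.dw]
  simp only [Matrix.cons_val]
  rw [pow_succ, pow_add]
  linear_combination X 0 ^ κ * X 1 * hq + ((κ + m + 1 : ℕ) : S) * X 0 ^ κ * X 0 ^ m * X 2 * ha +
    X 0 ^ κ * X 0 ^ m * X 3 * hb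

/-- Reduces near freeness to solving x^m | p P + q Q. The nonzero integer `K` in `hgen` is a unit of
`S`; it keeps the later computations free of denominators. -/
theorem PencilData.isNearlyFree (h : PencilData f κ m P Q) {d₂ d₃ : ℕ}
    (hd₂ : 1 ≤ d₂) (hd₃ : d₂ ≤ d₃) (a b : Fin 3 → S)
    (ha : ∀ i, (a i).IsHomogeneous (![d₂, d₃, d₃] i))
    (hb : ∀ i, (X 0 ^ κ * b i).IsHomogeneous (![d₂, d₃, d₃] i))
    (hdvd : ∀ i, X 0 ^ m ∣ a i * P + b i * Q)
    (ha' : ∀ i, ∃ a₁ a₂, a i = X 0 * a₁ + X 1 * a₂)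
    (hb' : ∀ i, ∃ b₁ b₂, X 0 ^ κ * b i = X 0 * b₁ + X 1 * b₂)
    (hgen : ∀ p q : S, X 0 ^ m ∣ p * P + q * Q → ∃ K : ℕ, K ≠ 0 ∧
      ∃ r : Fin 3 → S, K * p = ∑ i, r i * a i ∧ K * q = ∑ i, r i * b i)
    (k : Fin 3 → S) (hk : ∀ i, (k i).IsHomogeneous (d₃ + 1 - ![d₂, d₃, d₃] i)) (hk0 : k ≠ 0)
    (hka : ∑ i, k i * a i = 0) (hkb : ∑ i, k i * b i = 0)
    (hrel : ∀ r : Fin 3 → S, ∑ i, r i * a i = 0 → ∑ i, r i * b i = 0 → ∃ t : S, r = t • k) :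
    IsNearlyFreeWithExponents f 1 d₂ d₃ := by
  have hX : (X 0 ^ κ : S) ≠ 0 := pow_ne_zero _ (X_ne_zero _)
  have hsum : ∀ r : Fin 3 → S, ∑ i, r i * (X 0 ^ κ * b i) = X 0 ^ κ * ∑ i, r i * b i := by
    intro r
    rw [Finset.mul_sum]
    exact Finset.sum_congr rfl fun i _ => by ring
  refine isNearlyFree_of_projection h.homogeneous h.dz h.dw hd₂ hd₃ a
    (fun i => X 0 ^ κ * b i) ha hb (fun i => h.exists_lift (hdvd i) (ha' i) (hb' i)) ?_
    k hk hk0 hka ?_ ?_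
  · intro v hv
    obtain ⟨q, hq, hdiv⟩ := h.dvd_of_mem hv
    obtain ⟨K, hK, r, h1, h2⟩ := hgen _ _ hdiv
    obtain ⟨u, hu⟩ := (isUnit_natCast hK).exists_left_inv
    refine ⟨fun i => u * r i, ?_, ?_⟩
    · simp only [mul_assoc, ← Finset.mul_sum, ← h1]
      rw [← mul_assoc, hu, one_mul]
    · rw [hsum, hq]
      simp only [mul_assoc, ← Finset.mul_sum, ← h2]
      rw [← mul_assoc u, hu, one_mul]
  · rw [hsum, hkb, mul_zero]
  · intro r h1 h2
    rw [hsum] at h2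
    exact hrel r h1 ((mul_eq_zero.1 h2).resolve_left hX)

theorem PencilData.isFree (h : PencilData f κ m P Q) {d₂ d₃ : ℕ}
    (hd₂ : 1 ≤ d₂) (hd₃ : d₂ ≤ d₃) (a b : Fin 2 → S)
    (ha : ∀ i, (a i).IsHomogeneous (![d₂, d₃] i))
    (hb : ∀ i, (X 0 ^ κ * b i).IsHomogeneous (![d₂, d₃] i))
    (hdvd : ∀ i, X 0 ^ m ∣ a i * P + b i * Q)
    (ha' : ∀ i, ∃ a₁ a₂, a i = X 0 * a₁ + X 1 * a₂)
    (hb' : ∀ i, ∃ b₁ b₂, X 0 ^ κ * b i = X 0 * b₁ + X 1 * b₂)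
    (hgen : ∀ p q : S, X 0 ^ m ∣ p * P + q * Q → ∃ K : ℕ, K ≠ 0 ∧
      ∃ r : Fin 2 → S, K * p = ∑ i, r i * a i ∧ K * q = ∑ i, r i * b i)
    (hrel : ∀ r : Fin 2 → S, ∑ i, r i * a i = 0 → ∑ i, r i * b i = 0 → r = 0) :
    IsFreeWithExponents f ![1, d₂, d₃] := by
  have hX : (X 0 ^ κ : S) ≠ 0 := pow_ne_zero _ (X_ne_zero _)
  have hsum : ∀ r : Fin 2 → S, ∑ i, r i * (X 0 ^ κ * b i) = X 0 ^ κ * ∑ i, r i * b i := by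
    intro r
    rw [Finset.mul_sum]
    exact Finset.sum_congr rfl fun i _ => by ring
  refine isFree_of_projection h.homogeneous h.dz h.dw hd₂ hd₃ a
    (fun i => X 0 ^ κ * b i) ha hb (fun i => h.exists_lift (hdvd i) (ha' i) (hb' i)) ?_ ?_
  · intro v hv
    obtain ⟨q, hq, hdiv⟩ := h.dvd_of_mem hv
    obtain ⟨K, hK, r, h1, h2⟩ := hgen _ _ hdiv
    obtain ⟨u, hu⟩ := (isUnit_natCast hK).exists_left_inv
    refine ⟨fun i => u * r i, ?_, ?_⟩
    · simp only [mul_assoc, ← Finset.mul_sum, ← h1]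
      rw [← mul_assoc, hu, one_mul]
    · rw [hsum, hq]
      simp only [mul_assoc, ← Finset.mul_sum, ← h2]
      rw [← mul_assoc u, hu, one_mul]
  · intro r h1 h2
    rw [hsum] at h2
    exact hrel r h1 ((mul_eq_zero.1 h2).resolve_left hX)

end SurfP3

namespace SurfP3

/-! ### Syzygies of the pencils `x ^ (d - 1) z + y ^ d + x ^ (d - 2) y w + x ^ k y ^ (d - k)` -/

theorem isHomogeneous_monomial_xyw (c i j l : ℕ) {n : ℕ} (h : i + j + l = n) :
    ((c : S) * X 0 ^ i * X 1 ^ j * X 3 ^ l).IsHomogeneous n := by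
  have h0 : ((c : S)).IsHomogeneous 0 := by
    have := isHomogeneous_C (Fin 4) (c : ℂ)
    simpa using this
  have := ((h0.mul (isHomogeneous_X_pow (0 : Fin 4) i)).mul
    (isHomogeneous_X_pow (1 : Fin 4) j)).mul (isHomogeneous_X_pow (3 : Fin 4) l)
  rwa [zero_add, h] at this

theorem isHomogeneous_of_eq {p q : S} {m n : ℕ} (hp : p.IsHomogeneous m) (h : q = p)
    (hmn : m = n) : q.IsHomogeneous n := by
  rwa [h, ← hmn]

theorem prime_X_one : Prime (X 1 : S) := X_prime

theorem evalXZero_X_zero : evalXZero (X 0) = 0 := by simp [evalXZero]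

theorem evalXZero_X_one : evalXZero (X 1) = X 1 := by simp [evalXZero]

theorem evalXZero_X_three : evalXZero (X 3) = X 3 := by simp [evalXZero]

theorem exists_eq_evalXZero_add (p : S) : ∃ q, p = evalXZero p + X 0 * q := by
  obtain ⟨q, hq⟩ := X_zero_dvd_sub_evalXZero p
  exact ⟨q, by linear_combination hq⟩

theorem not_X_one_dvd_X_three : ¬ (X 1 : S) ∣ X 3 := by
  rw [X_dvd_X]
  decide

theorem not_X_one_dvd_natCast_mul {c : ℕ} (hc : c ≠ 0) {p : S} (hp : ¬ (X 1 : S) ∣ p) :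
    ¬ (X 1 : S) ∣ (c : S) * p := by
  rwa [(isUnit_natCast hc).dvd_mul_left]

theorem not_X_zero_dvd_natCast_mul {c : ℕ} (hc : c ≠ 0) {p : S} (hp : ¬ (X 0 : S) ∣ p) :
    ¬ (X 0 : S) ∣ (c : S) * p := by
  rwa [(isUnit_natCast hc).dvd_mul_left]

theorem not_X_zero_dvd_pow (n : ℕ) : ¬ (X 0 : S) ∣ X 1 ^ n :=
  fun h => not_X_zero_dvd_X_one (prime_X_zero.dvd_of_dvd_pow h)

theorem not_X_zero_dvd_add {p q : S} (hp : (X 0 : S) ∣ p) (hq : ¬ (X 0 : S) ∣ q) :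
    ¬ (X 0 : S) ∣ p + q := by
  rwa [dvd_add_right hp]

variable {f : S}

/-- The pencils without the term `x ^ k y ^ (d - k)`. -/
theorem PencilData.isNearlyFree_of_monomial {κ : ℕ}
    (h : PencilData f (κ + 1) 1 (((κ + 2 : ℕ) : S) * X 3) (((κ + 4 : ℕ) : S) * X 1 ^ (κ + 2))) :
    IsNearlyFreeWithExponents f 1 1 (κ + 2) := by
  have hw : ∀ i, (![X 0, 0, ((κ + 4 : ℕ) : S) * X 1 ^ (κ + 2)] i : S).IsHomogeneous
      (![1, κ + 2, κ + 2] i) := by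
    intro i
    fin_cases i
    · exact isHomogeneous_X _ _
    · exact isHomogeneous_zero _ _ _
    · simpa using isHomogeneous_monomial_xyw (κ + 4) 0 (κ + 2) 0 (by omega)
  refine h.isNearlyFree le_rfl (by omega) ![X 0, 0, ((κ + 4 : ℕ) : S) * X 1 ^ (κ + 2)]
    ![0, X 0, -(((κ + 2 : ℕ) : S) * X 3)] hw ?_ ?_ ?_ ?_ ?_
    ![((κ + 4 : ℕ) : S) * X 1 ^ (κ + 2), -(((κ + 2 : ℕ) : S) * X 3), -X 0] ?_ ?_ ?_ ?_ ?_
  · intro i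
    fin_cases i
    · simpa using isHomogeneous_zero _ _ _
    · simpa [← pow_succ] using isHomogeneous_X_pow (R := ℂ) (0 : Fin 4) (κ + 1 + 1)
    · have := (isHomogeneous_monomial_xyw (κ + 2) (κ + 1) 0 1 (n := κ + 2) (by omega)).neg
      exact isHomogeneous_of_eq (this) (by simp; ring) rfl
  · intro i
    fin_cases i
    · exact ⟨((κ + 2 : ℕ) : S) * X 3, by simp⟩
    · exact ⟨((κ + 4 : ℕ) : S) * X 1 ^ (κ + 2), by simp⟩
    · exact ⟨0, by simp; ring⟩
  · intro i
    fin_cases i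
    · exact ⟨1, 0, by simp⟩
    · exact ⟨0, 0, by simp⟩
    · exact ⟨0, ((κ + 4 : ℕ) : S) * X 1 ^ (κ + 1), by simp; ring⟩
  · intro i
    fin_cases i
    · exact ⟨0, 0, by simp⟩
    · exact ⟨X 0 ^ (κ + 1), 0, by simp; ring⟩
    · exact ⟨-(X 0 ^ κ * (((κ + 2 : ℕ) : S) * X 3)), 0, by simp; ring⟩
  -- Here m = 1, so the congruence lives modulo x and is solved by the Koszul relation between w and
  -- y^(κ+2). The parts of `p` and `q` divisible by x are multiples of the first two generators.
  · intro p q hpq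
    rw [pow_one, X_zero_dvd_iff] at hpq
    simp only [map_add, map_mul, map_pow, map_natCast, evalXZero_X_one,
      evalXZero_X_three] at hpq
    have hy : X 1 ^ (κ + 2) ∣ evalXZero p := by
      refine prime_X_one.pow_dvd_of_dvd_mul_right _
        (not_X_one_dvd_natCast_mul (c := κ + 2) (by omega) not_X_one_dvd_X_three) ?_
      exact ⟨-(((κ + 4 : ℕ) : S) * evalXZero q), by linear_combination hpq⟩
    obtain ⟨τ, hτ⟩ := hy
    obtain ⟨σ, hσ⟩ := exists_eq_evalXZero_add p
    obtain ⟨σ', hσ'⟩ := exists_eq_evalXZero_add q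
    rw [hτ] at hpq hσ
    have hq : ((κ + 4 : ℕ) : S) * evalXZero q = -(((κ + 2 : ℕ) : S) * X 3 * τ) := by
      apply mul_left_cancel₀ (pow_ne_zero (κ + 2) (X_ne_zero (R := ℂ) (1 : Fin 4)))
      linear_combination hpq
    refine ⟨κ + 4, by omega, ![((κ + 4 : ℕ) : S) * σ, ((κ + 4 : ℕ) : S) * σ', τ], ?_, ?_⟩
    · simp only [Fin.sum_univ_three, Matrix.cons_val]
      linear_combination ((κ + 4 : ℕ) : S) * hσ
    · simp only [Fin.sum_univ_three, Matrix.cons_val]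
      linear_combination ((κ + 4 : ℕ) : S) * hσ' + hq
  · intro i
    fin_cases i
    · simpa using isHomogeneous_monomial_xyw (κ + 4) 0 (κ + 2) 0 (by omega)
    · simpa using (isHomogeneous_monomial_xyw (κ + 2) 0 0 1 (n := 1) (by omega)).neg
    · simpa using (isHomogeneous_X ℂ (0 : Fin 4)).neg
  · intro h0
    have := congrFun h0 2
    simp at this
  · simp [Fin.sum_univ_three]
    ring
  · simp [Fin.sum_univ_three]
    ring
  · intro r h1 h2
    simp only [Fin.sum_univ_three, Matrix.cons_val] at h1 h2
    have hx : (X 0 : S) ∣ r 2 := by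
      have : X 0 ^ 1 ∣ r 2 * (((κ + 4 : ℕ) : S) * X 1 ^ (κ + 2)) :=
        ⟨-r 0, by linear_combination h1⟩
      simpa using pow_X_zero_dvd_of_dvd_mul this
        (not_X_zero_dvd_natCast_mul (by omega) (not_X_zero_dvd_pow _))
    obtain ⟨t, ht⟩ := hx
    rw [ht] at h1 h2
    have hX : (X 0 : S) ≠ 0 := X_ne_zero _
    refine ⟨-t, funext fun i => ?_⟩
    fin_cases i
    · apply mul_left_cancel₀ hX
      change X 0 * r 0 = X 0 * (-t * (((κ + 4 : ℕ) : S) * X 1 ^ (κ + 2)))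
      linear_combination h1
    · apply mul_left_cancel₀ hX
      change X 0 * r 1 = X 0 * (-t * -(((κ + 2 : ℕ) : S) * X 3))
      linear_combination h2
    · simp [ht]
      ring

/-- The form `P` of the pencil with `k = κ + 1` and `d = κ + M + 3`. -/
noncomputable def pencilP (κ M : ℕ) : S :=
  ((κ + M + 1 : ℕ) : S) * X 0 ^ M * X 3 + ((κ + 1 : ℕ) : S) * X 1 ^ (M + 1)

/-- The form `Q` of the pencil with `k = κ + 1` and `d = κ + M + 3`. -/
noncomputable def pencilQ (κ M : ℕ) : S :=
  X 1 ^ M * (((κ + M + 3 : ℕ) : S) * X 1 ^ (κ + 1) + ((M + 2 : ℕ) : S) * X 0 ^ (κ + 1))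

theorem not_X_zero_dvd_pencilP (κ M : ℕ) : ¬ (X 0 : S) ∣ pencilP κ (M + 1) := by
  refine not_X_zero_dvd_add ⟨((κ + (M + 1) + 1 : ℕ) : S) * X 0 ^ M * X 3, by ring⟩ ?_
  exact not_X_zero_dvd_natCast_mul (by omega) (not_X_zero_dvd_pow _)

/-- The case `k ≥ m + 1`. -/
theorem PencilData.isFree_of_lt {κ M j : ℕ} (hκ : κ = M + 2 + j)
    (h : PencilData f κ (M + 2) (pencilP κ (M + 1)) (pencilQ κ (M + 1))) :
    IsFreeWithExponents f ![1, M + 2, κ] := by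
  subst hκ
  set κ := M + 2 + j with hκ
  -- Up to the factor (κ+1)², this is Q / P modulo x^(M+2). The second term of Q vanishes there
  -- because κ + 1 ≥ M + 2, and one correction term suffices because x^(2(M+1)) vanishes too. As x
  -- does not divide P, the condition on (p, q) becomes x^(M+2) | (κ+1)² p + α q, whose solutions
  -- form a free module.
  set α : S := ((κ + M + 4 : ℕ) : S) * (((κ + 1 : ℕ) : S) * X 1 ^ κ
    - ((κ + M + 2 : ℕ) : S) * X 1 ^ j * X 0 ^ (M + 1) * X 3) with hα
  obtain ⟨β, key⟩ : ∃ β, ((κ + 1 : ℕ) : S) ^ 2 * pencilQ κ (M + 1) - α * pencilP κ (M + 1) =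
      X 0 ^ (M + 2) * β := by
    refine ⟨((κ + M + 4 : ℕ) : S) * ((κ + M + 2 : ℕ) : S) ^ 2 * X 1 ^ j * X 0 ^ M * X 3 ^ 2
      + ((κ + 1 : ℕ) : S) ^ 2 * ((M + 3 : ℕ) : S) * X 1 ^ (M + 1) * X 0 ^ (j + 1), ?_⟩
    simp only [hα, hκ, pencilP, pencilQ]
    push_cast
    ring
  refine h.isFree (by omega) (by omega) ![X 0 ^ (M + 2), -α] ![0, ((κ + 1 : ℕ) : S) ^ 2]
    ?_ ?_ ?_ ?_ ?_ ?_ ?_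
  · intro i
    fin_cases i
    · exact isHomogeneous_X_pow _ _
    · have h1 := isHomogeneous_monomial_xyw ((κ + M + 4) * (κ + 1)) 0 κ 0 (n := κ) (by omega)
      have h2 := isHomogeneous_monomial_xyw ((κ + M + 4) * (κ + M + 2)) (M + 1) j 1 (n := κ)
        (by omega)
      exact isHomogeneous_of_eq ((h1.sub h2).neg) (by simp [hα]; ring) rfl
  · intro i
    fin_cases i
    · simpa using isHomogeneous_zero _ _ _
    · have h1 := isHomogeneous_monomial_xyw ((κ + 1) ^ 2) κ 0 0 (n := κ) (by omega)
      exact isHomogeneous_of_eq (h1) (by simp; ring) rfl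
  · intro i
    fin_cases i
    · exact ⟨pencilP κ (M + 1), by simp⟩
    · exact ⟨β, Eq.trans (by simp; ring) key⟩
  · intro i
    fin_cases i
    · exact ⟨X 0 ^ (M + 1), 0, by simp; ring⟩
    · refine ⟨((κ + M + 4 : ℕ) : S) * ((κ + M + 2 : ℕ) : S) * X 1 ^ j * X 0 ^ M * X 3,
        -(((κ + M + 4 : ℕ) : S) * ((κ + 1 : ℕ) : S) * X 1 ^ (M + 1 + j)), ?_⟩
      simp [hα, hκ]
      ring
  · intro i
    fin_cases i
    · exact ⟨0, 0, by simp⟩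
    · refine ⟨X 0 ^ (M + 1 + j) * ((κ + 1 : ℕ) : S) ^ 2, 0, ?_⟩
      simp [hκ]
      ring
  · intro p q hpq
    have h1 : X 0 ^ (M + 2) ∣ (((κ + 1 : ℕ) : S) ^ 2 * p + q * α) * pencilP κ (M + 1) := by
      obtain ⟨s, hs⟩ := hpq
      exact ⟨((κ + 1 : ℕ) : S) ^ 2 * s - q * β,
        by linear_combination ((κ + 1 : ℕ) : S) ^ 2 * hs - q * key⟩
    obtain ⟨u, hu⟩ := pow_X_zero_dvd_of_dvd_mul h1 (not_X_zero_dvd_pencilP κ M)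
    refine ⟨(κ + 1) ^ 2, by positivity, ![u, q], ?_, ?_⟩
    · simp [Fin.sum_univ_two]
      push_cast at hu
      linear_combination hu
    · simp [Fin.sum_univ_two]
      ring
  · intro r h1 h2
    simp only [Fin.sum_univ_two, Matrix.cons_val_zero, Matrix.cons_val_one] at h1 h2
    have hk : ((κ + 1 : ℕ) : S) ^ 2 ≠ 0 := pow_ne_zero _ (natCast_ne_zero (by omega))
    have hr1 : r 1 = 0 := by
      rw [mul_zero, zero_add] at h2
      exact (mul_eq_zero.1 h2).resolve_right hk
    rw [hr1, zero_mul, add_zero] at h1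
    have hr0 : r 0 = 0 := (mul_eq_zero.1 h1).resolve_right (pow_ne_zero _ (X_ne_zero _))
    funext i
    fin_cases i
    · exact hr0
    · exact hr1

/-- The cases `k = m` and `k = m - 1`. -/
theorem PencilData.isNearlyFree_of_eq {κ M n : ℕ} {W V : S} (hM : κ + n = M + 1)
    (hW : W.IsHomogeneous 1) (hW1 : ¬ X 1 ∣ evalXZero W)
    (hV : ((κ + M + 4 : ℕ) : S) * X 1 ^ κ * pencilP κ (M + 1) - ((κ + 1 : ℕ) : S) * pencilQ κ (M + 1) =
      X 0 ^ (M + 1) * (X 1 ^ κ * W + X 0 * V))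
    (h : PencilData f κ (M + 2) (pencilP κ (M + 1)) (pencilQ κ (M + 1))) :
    IsNearlyFreeWithExponents f 1 (κ + 1) (M + 2) := by
  have hP : pencilP κ (M + 1) = X 0 ^ (M + 1) * (((κ + M + 2 : ℕ) : S) * X 3)
      + ((κ + 1 : ℕ) : S) * X 1 ^ (κ + n + 1) := by
    rw [hM, pencilP]
    push_cast
    ring
  have hX : (X 0 : S) ≠ 0 := X_ne_zero _
  have hk : ((κ + 1 : ℕ) : S) ≠ 0 := natCast_ne_zero (by omega)
  refine h.isNearlyFree (by omega) (by omega)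
    -- By `hV`, the pair ((κ+M+4) y^κ, -(κ+1)) solves the congruence only modulo x^(M+1), with error
    -- x^(M+1) y^κ W. Multiplying it by x gives the first generator. Multiplying it by (κ+1) y^(n+1)
    -- makes the error x^(M+1) W P up to higher order in x, which the term -x^(M+1) W removes: this
    -- is the second generator. The third is (x^m, 0).
    ![((κ + M + 4 : ℕ) : S) * X 0 * X 1 ^ κ,
      ((κ + 1 : ℕ) : S) * ((κ + M + 4 : ℕ) : S) * X 1 ^ (κ + n + 1) - X 0 ^ (M + 1) * W, X 0 ^ (M + 2)]
    ![-(((κ + 1 : ℕ) : S) * X 0), -(((κ + 1 : ℕ) : S) ^ 2 * X 1 ^ (n + 1)), 0] ?_ ?_ ?_ ?_ ?_ ?_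
    ![-(((κ + 1 : ℕ) : S) * X 1 ^ (n + 1)), X 0, W] ?_ ?_ ?_ ?_ ?_
  · intro i
    fin_cases i
    · simpa using isHomogeneous_monomial_xyw (κ + M + 4) 1 κ 0 (n := κ + 1) (by omega)
    · have h1 := isHomogeneous_monomial_xyw ((κ + 1) * (κ + M + 4)) 0 (κ + n + 1) 0 (n := M + 2)
        (by omega)
      have h2 := (isHomogeneous_X_pow (R := ℂ) (0 : Fin 4) (M + 1)).mul hW
      exact isHomogeneous_of_eq (h1.sub h2) (by simp) rfl
    · exact isHomogeneous_X_pow _ _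
  · intro i
    fin_cases i
    · have h1 := isHomogeneous_monomial_xyw (κ + 1) (κ + 1) 0 0 (n := κ + 1) (by omega)
      exact isHomogeneous_of_eq (h1.neg) (by simp; ring) rfl
    · have h1 := isHomogeneous_monomial_xyw ((κ + 1) ^ 2) κ (n + 1) 0 (n := M + 2) (by omega)
      exact isHomogeneous_of_eq (h1.neg) (by simp; ring) rfl
    · simpa using isHomogeneous_zero _ _ _
  · intro i
    fin_cases i
    · exact ⟨X 1 ^ κ * W + X 0 * V, Eq.trans (by simp; ring) (congrArg (X 0 * ·) hV |>.trans
        (by ring))⟩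
    · refine ⟨((κ + 1 : ℕ) : S) * X 1 ^ (n + 1) * V - ((κ + M + 2 : ℕ) : S) * X 0 ^ M * X 3 * W, ?_⟩
      simp only [Fin.mk_one, Matrix.cons_val_one, Matrix.cons_val_zero]
      rw [hP] at hV ⊢
      linear_combination ((κ + 1 : ℕ) : S) * X 1 ^ (n + 1) * hV
    · exact ⟨pencilP κ (M + 1), by simp⟩
  · intro i
    fin_cases i
    · exact ⟨((κ + M + 4 : ℕ) : S) * X 1 ^ κ, 0, by simp; ring⟩
    · exact ⟨-(X 0 ^ M * W), ((κ + 1 : ℕ) : S) * ((κ + M + 4 : ℕ) : S) * X 1 ^ (κ + n), by simp; ring⟩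
    · exact ⟨X 0 ^ (M + 1), 0, by simp; ring⟩
  · intro i
    fin_cases i
    · exact ⟨-(((κ + 1 : ℕ) : S) * X 0 ^ κ), 0, by simp; ring⟩
    · exact ⟨0, -(((κ + 1 : ℕ) : S) ^ 2 * X 0 ^ κ * X 1 ^ n), by simp; ring⟩
    · exact ⟨0, 0, by simp⟩
  · intro p q hpq
    set A : S := ((κ + 1 : ℕ) : S) * p + ((κ + M + 4 : ℕ) : S) * X 1 ^ κ * q with hA
    obtain ⟨s, hs⟩ := hpq
    have e1 : A * pencilP κ (M + 1) = X 0 ^ (M + 2) * (((κ + 1 : ℕ) : S) * s)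
        + q * (X 0 ^ (M + 1) * (X 1 ^ κ * W + X 0 * V)) := by
      rw [← hV, hA]
      linear_combination ((κ + 1 : ℕ) : S) * hs
    obtain ⟨u, hu⟩ : X 0 ^ (M + 1) ∣ A := by
      refine pow_X_zero_dvd_of_dvd_mul ?_ (not_X_zero_dvd_pencilP κ M)
      rw [e1]
      exact ⟨X 0 * (((κ + 1 : ℕ) : S) * s) + q * (X 1 ^ κ * W + X 0 * V), by ring⟩
    have e2 : u * pencilP κ (M + 1) - q * X 1 ^ κ * W = X 0 * (((κ + 1 : ℕ) : S) * s + q * V) := by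
      apply mul_left_cancel₀ (pow_ne_zero (M + 1) hX)
      rw [hu] at e1
      linear_combination e1
    have e3 : evalXZero u * (((κ + 1 : ℕ) : S) * X 1 ^ (n + 1)) = evalXZero q * evalXZero W := by
      have := congrArg evalXZero e2
      rw [hP] at this
      simp only [map_sub, map_add, map_mul, map_pow, map_natCast, evalXZero_X_one,
        evalXZero_X_zero, zero_mul, zero_pow (Nat.succ_ne_zero M), zero_add] at this
      apply mul_left_cancel₀ (pow_ne_zero κ (X_ne_zero (R := ℂ) (1 : Fin 4)))
      linear_combination this
    -- Since y does not divide W modulo x, `q` is y^(n+1) τ + x σ. Subtracting multiples of the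
    -- first two generators then removes `q` and leaves a multiple of (x^m, 0).
    obtain ⟨τ, hτ⟩ : X 1 ^ (n + 1) ∣ evalXZero q :=
      prime_X_one.pow_dvd_of_dvd_mul_right _ hW1
        ⟨evalXZero u * ((κ + 1 : ℕ) : S), by linear_combination -e3⟩
    obtain ⟨σ, hσ⟩ := exists_eq_evalXZero_add q
    rw [hτ] at hσ
    obtain ⟨ρ, hρ⟩ : X 0 ^ (M + 2) ∣ ((κ + 1 : ℕ) : S) ^ 2 * p
        + ((κ + 1 : ℕ) : S) * σ * (((κ + M + 4 : ℕ) : S) * X 0 * X 1 ^ κ)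
        + τ * (((κ + 1 : ℕ) : S) * ((κ + M + 4 : ℕ) : S) * X 1 ^ (κ + n + 1) - X 0 ^ (M + 1) * W) := by
      refine pow_X_zero_dvd_of_dvd_mul ?_ (not_X_zero_dvd_pencilP κ M)
      refine ⟨((κ + 1 : ℕ) : S) ^ 2 * s + ((κ + 1 : ℕ) : S) * σ * (X 1 ^ κ * W + X 0 * V) +
        τ * (((κ + 1 : ℕ) : S) * X 1 ^ (n + 1) * V - ((κ + M + 2 : ℕ) : S) * X 0 ^ M * X 3 * W), ?_⟩
      rw [hP] at hV hs ⊢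
      rw [hσ] at hs
      linear_combination ((κ + 1 : ℕ) : S) ^ 2 * hs + ((κ + 1 : ℕ) : S) * (σ * X 0 + τ * X 1 ^ (n + 1)) * hV
    refine ⟨(κ + 1) ^ 2, by positivity, ![-(((κ + 1 : ℕ) : S) * σ), -τ, ρ], ?_, ?_⟩
    · simp only [Fin.sum_univ_three, Matrix.cons_val]
      push_cast at hρ ⊢
      linear_combination hρ
    · simp only [Fin.sum_univ_three, Matrix.cons_val]
      push_cast at hσ ⊢
      linear_combination ((κ : S) + 1) ^ 2 * hσ
  · intro i
    fin_cases i
    · have h1 := isHomogeneous_monomial_xyw (κ + 1) 0 (n + 1) 0 (n := M + 2 + 1 - (κ + 1))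
        (by omega)
      simpa using h1.neg
    · simpa using isHomogeneous_X ℂ (0 : Fin 4)
    · simpa using hW
  · intro h0
    have := congrFun h0 1
    simp at this
  · simp [Fin.sum_univ_three]
    ring
  · simp [Fin.sum_univ_three]
    ring
  · intro r h1 h2
    simp only [Fin.sum_univ_three, Matrix.cons_val] at h1 h2
    have h2' : r 0 * X 0 + r 1 * (((κ + 1 : ℕ) : S) * X 1 ^ (n + 1)) = 0 := by
      apply mul_left_cancel₀ hk
      linear_combination -h2
    obtain ⟨t, ht⟩ : (X 0 : S) ∣ r 1 := by
      have : X 0 ^ 1 ∣ r 1 * (((κ + 1 : ℕ) : S) * X 1 ^ (n + 1)) :=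
        ⟨-r 0, by linear_combination h2'⟩
      simpa using pow_X_zero_dvd_of_dvd_mul this
        (not_X_zero_dvd_natCast_mul (by omega) (not_X_zero_dvd_pow _))
    have hr0 : r 0 = -(t * (((κ + 1 : ℕ) : S) * X 1 ^ (n + 1))) := by
      apply mul_left_cancel₀ hX
      rw [ht] at h2'
      linear_combination h2'
    have hr2 : r 2 = t * W := by
      apply mul_left_cancel₀ (pow_ne_zero (M + 2) hX)
      rw [ht, hr0] at h1
      linear_combination h1
    refine ⟨t, funext fun i => ?_⟩
    fin_cases i
    · simp [hr0]
    · simp [ht]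
      ring
    · simp [hr2]

end SurfP3

namespace SurfP3

/-- The case `k ≤ m - 2`; the values of the nonzero coefficients play no role. -/
theorem PencilData.isNearlyFree_of_gt {f : S} {κ ν a b k l : ℕ} (ha : a ≠ 0) (hb : b ≠ 0)
    (hk : k ≠ 0) (hl : l ≠ 0)
    (h : PencilData f κ (κ + ν + 3)
      ((b : S) * X 0 ^ (κ + ν + 2) * X 3 + (k : S) * X 1 ^ (κ + ν + 3))
      (X 1 ^ (κ + ν + 2) * ((a : S) * X 1 ^ (κ + 1) + (l : S) * X 0 ^ (κ + 1)))) :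
    IsNearlyFreeWithExponents f 1 (κ + 2) (κ + ν + 2) := by
  set P : S := (b : S) * X 0 ^ (κ + ν + 2) * X 3 + (k : S) * X 1 ^ (κ + ν + 3) with hP
  set Q : S := X 1 ^ (κ + ν + 2) * ((a : S) * X 1 ^ (κ + 1) + (l : S) * X 0 ^ (κ + 1)) with hQ
  -- The second coordinates of the generators will be -k times xy, `E` and x^(ν+2); the definition
  -- of `E` is itself the relation x E = k l y^(ν+1)·xy + a b w·x^(ν+2).
  set E : S := (a : S) * (b : S) * X 3 * X 0 ^ (ν + 1) + (k : S) * (l : S) * X 1 ^ (ν + 2) with hE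
  have hX : (X 0 : S) ≠ 0 := X_ne_zero _
  have hY : (X 1 : S) ≠ 0 := X_ne_zero _
  have hPx : ¬ (X 0 : S) ∣ P :=
    not_X_zero_dvd_add ⟨(b : S) * X 0 ^ (κ + ν + 1) * X 3, by ring⟩
      (not_X_zero_dvd_natCast_mul hk (not_X_zero_dvd_pow _))
  have hkl : k * l ≠ 0 := mul_ne_zero hk hl
  have hv0 : ((a : S) * X 0 * X 1 ^ (κ + 1) + (l : S) * X 0 ^ (κ + 2)) * P
      + -((k : S) * X 0 * X 1) * Q = X 0 ^ (κ + ν + 3) * ((a : S) * (b : S) * X 1 ^ (κ + 1) * X 3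
        + (l : S) * (b : S) * X 0 ^ (κ + 1) * X 3) := by
    rw [hP, hQ]
    ring
  have hv1 : ((a : S) * X 1 ^ κ * E + (k : S) * (l : S) ^ 2 * X 0 ^ (κ + 1) * X 1 ^ (ν + 1)) * P
      + -((k : S) * E) * Q = X 0 ^ (κ + ν + 3) * (((a : S) * (b : S)) ^ 2 * X 0 ^ ν * X 1 ^ κ * X 3 ^ 2
        + (k : S) * (l : S) ^ 2 * (b : S) * X 0 ^ κ * X 1 ^ (ν + 1) * X 3) := by
    rw [hP, hQ, hE]
    ring
  have hv2 : ((a : S) * X 0 ^ (ν + 2) * X 1 ^ κ) * P + -((k : S) * X 0 ^ (ν + 2)) * Q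
      = X 0 ^ (κ + ν + 3) * ((a : S) * (b : S) * X 0 ^ (ν + 1) * X 1 ^ κ * X 3
        - (k : S) * (l : S) * X 1 ^ (κ + ν + 2)) := by
    rw [hP, hQ]
    ring
  have hEhom : E.IsHomogeneous (ν + 2) :=
    isHomogeneous_of_eq
      ((isHomogeneous_monomial_xyw (a * b) (ν + 1) 0 1 (n := ν + 2) (by omega)).add
        (isHomogeneous_monomial_xyw (k * l) 0 (ν + 2) 0 (by omega)))
      (by rw [hE]; push_cast; ring) rfl
  refine h.isNearlyFree (by omega) (by omega)
    ![(a : S) * X 0 * X 1 ^ (κ + 1) + (l : S) * X 0 ^ (κ + 2),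
      (a : S) * X 1 ^ κ * E + (k : S) * (l : S) ^ 2 * X 0 ^ (κ + 1) * X 1 ^ (ν + 1),
      (a : S) * X 0 ^ (ν + 2) * X 1 ^ κ]
    ![-((k : S) * X 0 * X 1), -((k : S) * E), -((k : S) * X 0 ^ (ν + 2))] ?_ ?_ ?_ ?_ ?_ ?_
    ![-((k : S) * (l : S) * X 1 ^ (ν + 1)), X 0, -((a : S) * (b : S) * X 3)] ?_ ?_ ?_ ?_ ?_
  · intro i
    fin_cases i
    · exact isHomogeneous_of_eq
        ((isHomogeneous_monomial_xyw a 1 (κ + 1) 0 (n := κ + 2) (by omega)).add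
          (isHomogeneous_monomial_xyw l (κ + 2) 0 0 (by omega))) (by simp) rfl
    · exact isHomogeneous_of_eq
        (((isHomogeneous_monomial_xyw a 0 κ 0 (n := κ) (by omega)).mul hEhom).add
          (isHomogeneous_monomial_xyw (k * l ^ 2) (κ + 1) (ν + 1) 0 (by omega)))
        (by simp) (by simp; omega)
    · exact isHomogeneous_of_eq
        (isHomogeneous_monomial_xyw a (ν + 2) κ 0 (n := κ + ν + 2) (by omega)) (by simp) rfl
  · intro i
    fin_cases i
    · exact isHomogeneous_of_eq
        (isHomogeneous_monomial_xyw k (κ + 1) 1 0 (n := κ + 2) (by omega)).neg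
        (by simp; ring) rfl
    · exact isHomogeneous_of_eq
        ((isHomogeneous_monomial_xyw k κ 0 0 (n := κ) (by omega)).mul hEhom).neg
        (by simp; ring) (by simp; omega)
    · exact isHomogeneous_of_eq
        (isHomogeneous_monomial_xyw k (κ + ν + 2) 0 0 (n := κ + ν + 2) (by omega)).neg
        (by simp; ring) rfl
  · intro i
    fin_cases i
    · exact ⟨_, hv0⟩
    · exact ⟨_, hv1⟩
    · exact ⟨_, hv2⟩
  · intro i
    fin_cases i
    · exact ⟨(a : S) * X 1 ^ (κ + 1) + (l : S) * X 0 ^ (κ + 1), 0, by simp; ring⟩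
    · exact ⟨(a : S) * X 1 ^ κ * ((a : S) * (b : S) * X 3 * X 0 ^ ν) + (k : S) * (l : S) ^ 2 * X 0 ^ κ * X 1 ^ (ν + 1),
        (a : S) * X 1 ^ κ * ((k : S) * (l : S) * X 1 ^ (ν + 1)), by simp [hE]; ring⟩
    · exact ⟨(a : S) * X 0 ^ (ν + 1) * X 1 ^ κ, 0, by simp; ring⟩
  · intro i
    fin_cases i
    · exact ⟨-((k : S) * X 0 ^ κ * X 1), 0, by simp; ring⟩
    · exact ⟨-((k : S) * X 0 ^ κ * ((a : S) * (b : S) * X 3 * X 0 ^ ν)),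
        -((k : S) * X 0 ^ κ * ((k : S) * (l : S) * X 1 ^ (ν + 1))), by simp [hE]; ring⟩
    · exact ⟨-((k : S) * X 0 ^ κ * X 0 ^ (ν + 1)), 0, by simp; ring⟩
  · intro p q ⟨s, hs⟩
    -- The remainder of the first division: k Q = a y^κ P - x^(κ+1) U. As κ + 1 < m, it does not
    -- vanish modulo x^m, and the division continues with P and U modulo x^(ν+2).
    set U : S := (a : S) * (b : S) * X 0 ^ (ν + 1) * X 1 ^ κ * X 3
      - (k : S) * (l : S) * X 1 ^ (κ + ν + 2) with hU
    have hUx : ¬ (X 0 : S) ∣ U := by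
      rw [hU, sub_eq_add_neg]
      refine not_X_zero_dvd_add ⟨(a : S) * (b : S) * X 0 ^ ν * X 1 ^ κ * X 3, by ring⟩ ?_
      rw [dvd_neg, ← Nat.cast_mul]
      exact not_X_zero_dvd_natCast_mul hkl (not_X_zero_dvd_pow _)
    obtain ⟨u, hu⟩ : X 0 ^ (κ + 1) ∣ (k : S) * p + (a : S) * X 1 ^ κ * q := by
      refine pow_X_zero_dvd_of_dvd_mul ⟨(k : S) * X 0 ^ (ν + 2) * s + q * U, ?_⟩ hPx
      rw [hQ] at hs
      rw [hU]
      linear_combination (k : S) * hs + (a : S) * X 1 ^ κ * q * hP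
    have e1 : u * P - q * U = X 0 ^ (ν + 2) * ((k : S) * s) := by
      apply mul_left_cancel₀ (pow_ne_zero (κ + 1) hX)
      rw [hQ] at hs
      rw [hU]
      linear_combination (k : S) * hs + (a : S) * X 1 ^ κ * q * hP - P * hu
    -- Modulo x, both P and U are constants times powers of y, and their quotient is -y / l.
    obtain ⟨c₁, hc₁⟩ : X 0 ^ 1 ∣ u * X 1 + (l : S) * q := by
      refine pow_X_zero_dvd_of_dvd_mul (q := (k : S) * X 1 ^ (κ + ν + 2))
        ⟨X 0 ^ (ν + 1) * ((k : S) * s) - u * ((b : S) * X 0 ^ (κ + ν + 1) * X 3)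
          + (a : S) * (b : S) * X 0 ^ ν * X 1 ^ κ * X 3 * q, ?_⟩
        (not_X_zero_dvd_natCast_mul hk (not_X_zero_dvd_pow _))
      rw [hU, hP] at e1
      linear_combination e1
    rw [pow_one] at hc₁
    have e2 : (a : S) * (b : S) * X 0 ^ ν * u * X 1 ^ (κ + 1) * X 3 - c₁ * U =
        X 0 ^ (ν + 1) * ((l : S) * ((k : S) * s - u * ((b : S) * X 0 ^ κ * X 3))) := by
      apply mul_left_cancel₀ hX
      rw [hP] at e1
      linear_combination (l : S) * e1 + U * hc₁ - u * X 1 * hU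
    obtain ⟨c₂, hc₂⟩ : X 0 ^ ν ∣ c₁ :=
      pow_X_zero_dvd_of_dvd_mul
        ⟨(a : S) * (b : S) * u * X 1 ^ (κ + 1) * X 3
          - X 0 * ((l : S) * ((k : S) * s - u * ((b : S) * X 0 ^ κ * X 3))), by linear_combination -e2⟩ hUx
    have e3 : (a : S) * (b : S) * u * X 1 ^ (κ + 1) * X 3 - c₂ * U =
        X 0 * ((l : S) * ((k : S) * s - u * ((b : S) * X 0 ^ κ * X 3))) := by
      apply mul_left_cancel₀ (pow_ne_zero ν hX)
      rw [hc₂] at e2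
      linear_combination e2
    have e4 : (a : S) * (b : S) * X 3 * evalXZero u = -((k : S) * (l : S) * evalXZero c₂ * X 1 ^ (ν + 1)) := by
      have := congrArg evalXZero e3
      rw [hU] at this
      simp only [map_sub, map_mul, map_pow, map_natCast, evalXZero_X_one,
        evalXZero_X_three, evalXZero_X_zero, zero_mul, mul_zero,
        zero_pow (Nat.succ_ne_zero ν)] at this
      apply mul_left_cancel₀ (pow_ne_zero (κ + 1) hY)
      linear_combination this
    obtain ⟨τ, hτ⟩ : X 1 ^ (ν + 1) ∣ evalXZero u := by
      refine prime_X_one.pow_dvd_of_dvd_mul_right _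
        (not_X_one_dvd_natCast_mul (mul_ne_zero ha hb) not_X_one_dvd_X_three) ?_
      exact ⟨-((k : S) * (l : S) * evalXZero c₂), by push_cast; linear_combination e4⟩
    obtain ⟨u₁, hu₁⟩ := exists_eq_evalXZero_add u
    obtain ⟨c₃, hc₃⟩ := exists_eq_evalXZero_add c₂
    rw [hτ] at hu₁ e4
    have e5 : (k : S) * (l : S) * evalXZero c₂ = -((a : S) * (b : S) * X 3 * τ) := by
      apply mul_left_cancel₀ (pow_ne_zero (ν + 1) hY)
      linear_combination e4
    have hq : ((k : S) * (l : S)) * ((l : S) * q) = -(τ * E) + (k : S) * (l : S) * c₃ * X 0 ^ (ν + 2)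
        - (k : S) * (l : S) * u₁ * (X 0 * X 1) := by
      rw [hE]
      rw [hc₂] at hc₁
      linear_combination (k : S) * (l : S) * hc₁ + X 0 ^ (ν + 1) * e5
        + (k : S) * (l : S) * X 0 ^ (ν + 1) * hc₃ - (k : S) * (l : S) * X 1 * hu₁
    obtain ⟨ρ, hρ⟩ : X 0 ^ (κ + ν + 3) ∣ ((k : S) * (l : S)) ^ 2 * p
        - ((k : S) * (l : S) * u₁ * ((a : S) * X 0 * X 1 ^ (κ + 1) + (l : S) * X 0 ^ (κ + 2))
          + τ * ((a : S) * X 1 ^ κ * E + (k : S) * (l : S) ^ 2 * X 0 ^ (κ + 1) * X 1 ^ (ν + 1))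
          - (k : S) * (l : S) * c₃ * ((a : S) * X 0 ^ (ν + 2) * X 1 ^ κ)) := by
      refine pow_X_zero_dvd_of_dvd_mul ⟨((k : S) * (l : S)) ^ 2 * s
        - (k : S) * (l : S) * u₁ * ((a : S) * (b : S) * X 1 ^ (κ + 1) * X 3 + (l : S) * (b : S) * X 0 ^ (κ + 1) * X 3)
        - τ * (((a : S) * (b : S)) ^ 2 * X 0 ^ ν * X 1 ^ κ * X 3 ^ 2
          + (k : S) * (l : S) ^ 2 * (b : S) * X 0 ^ κ * X 1 ^ (ν + 1) * X 3)
        + (k : S) * (l : S) * c₃ * U, ?_⟩ hPx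
      linear_combination ((k : S) * (l : S)) ^ 2 * hs - (k : S) * (l : S) * u₁ * hv0 - τ * hv1
        + (k : S) * (l : S) * c₃ * hv2 - (k : S) * Q * hq
    -- After the second coordinate is matched, a multiple of (x^m, 0) is left. The identity (l x^m,
    -- 0) = x^(ν+1)·(first generator) - y·(third generator) explains the terms in `ρ` and the extra
    -- factor `l`.
    refine ⟨(k * l) ^ 2 * l, mul_ne_zero (pow_ne_zero _ hkl) hl,
      ![(l : S) * ((k : S) * (l : S) * u₁) + ρ * X 0 ^ (ν + 1), (l : S) * τ,
        -((l : S) * ((k : S) * (l : S) * c₃)) - ρ * X 1], ?_, ?_⟩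
    · simp only [Fin.sum_univ_three, Matrix.cons_val]
      push_cast
      linear_combination (l : S) * hρ
    · simp only [Fin.sum_univ_three, Matrix.cons_val]
      push_cast
      linear_combination (k : S) * (l : S) * hq
  · intro i
    fin_cases i
    · exact isHomogeneous_of_eq
        (isHomogeneous_monomial_xyw (k * l) 0 (ν + 1) 0 (n := ν + 1) (by omega)).neg
        (by simp) (by simp; omega)
    · simpa using isHomogeneous_X ℂ (0 : Fin 4)
    · exact isHomogeneous_of_eq
        (isHomogeneous_monomial_xyw (a * b) 0 0 1 (n := 1) (by omega)).neg
        (by simp) (by simp)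
  · intro h0
    have := congrFun h0 1
    simp at this
  · simp only [Fin.sum_univ_three, Matrix.cons_val, hE]
    ring
  · simp only [Fin.sum_univ_three, Matrix.cons_val, hE]
    ring
  · intro r h1 h2
    simp only [Fin.sum_univ_three, Matrix.cons_val] at h1 h2
    have h3 : r 0 * (X 0 * X 1) + r 1 * E + r 2 * X 0 ^ (ν + 2) = 0 := by
      apply mul_left_cancel₀ (natCast_ne_zero hk)
      linear_combination -h2
    obtain ⟨t, ht⟩ : X 0 ^ 1 ∣ r 1 := by
      have hEx : ¬ (X 0 : S) ∣ E := by
        rw [hE]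
        refine not_X_zero_dvd_add ⟨(a : S) * (b : S) * X 3 * X 0 ^ ν, by ring⟩ ?_
        rw [← Nat.cast_mul]
        exact not_X_zero_dvd_natCast_mul hkl (not_X_zero_dvd_pow _)
      exact pow_X_zero_dvd_of_dvd_mul
        ⟨-(r 0 * X 1 + r 2 * X 0 ^ (ν + 1)), by linear_combination h3⟩ hEx
    rw [pow_one] at ht
    have h4 : r 0 * X 1 + t * E + r 2 * X 0 ^ (ν + 1) = 0 := by
      apply mul_left_cancel₀ hX
      rw [ht] at h3
      linear_combination h3
    have hr0 : r 0 = -(t * ((k : S) * (l : S) * X 1 ^ (ν + 1))) := by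
      apply mul_left_cancel₀ (mul_ne_zero (natCast_ne_zero hl) (pow_ne_zero (κ + 2) hX))
      rw [ht] at h1
      linear_combination h1 - (a : S) * X 0 * X 1 ^ κ * h4
    have hr2 : r 2 = -(t * ((a : S) * (b : S) * X 3)) := by
      apply mul_left_cancel₀ (pow_ne_zero (ν + 1) hX)
      rw [hr0, hE] at h4
      linear_combination h4
    refine ⟨t, funext fun i => ?_⟩
    fin_cases i
    · simp [hr0]
    · simp [ht]
      ring
    · simp [hr2]

end SurfP3

namespace SurfP3

/-! ### Exponents of the surfaces -/

/-- The surface with `k = κ + 1` and `d = κ + M + 3`. -/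
noncomputable def pencilSurface (κ M : ℕ) : S :=
  X 0 ^ (κ + M + 2) * X 2 + X 1 ^ (κ + M + 3) + X 0 ^ (κ + M + 1) * X 1 * X 3
    + X 0 ^ (κ + 1) * X 1 ^ (M + 2)

theorem pencilData_pencilSurface (κ M : ℕ) :
    PencilData (pencilSurface κ M) κ (M + 1) (pencilP κ M) (pencilQ κ M) := by
  have hX : ∀ i, (X i : S).IsHomogeneous 1 := isHomogeneous_X ℂ
  refine ⟨?_, ?_, ?_, ?_, ?_, ?_⟩
  · refine IsHomogeneous.add (IsHomogeneous.add (IsHomogeneous.add ?_ ?_) ?_) ?_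
    · exact isHomogeneous_of_eq (((hX 0).pow (κ + M + 2)).mul (hX 2)) rfl (by omega)
    · exact isHomogeneous_of_eq ((hX 1).pow (κ + M + 3)) rfl (by omega)
    · exact isHomogeneous_of_eq ((((hX 0).pow (κ + M + 1)).mul (hX 1)).mul (hX 3)) rfl (by omega)
    · exact isHomogeneous_of_eq (((hX 0).pow (κ + 1)).mul ((hX 1).pow (M + 2))) rfl (by omega)
  · simp [pencilSurface, pencilP, pderiv_X]
    ring
  · simp [pencilSurface, pencilQ, pderiv_X]
    ring
  · simp [pencilSurface, pderiv_X]
    ring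
  · simp [pencilSurface, pderiv_X]
    ring
  · rw [pencilQ]
    refine prime_X_zero.not_dvd_mul (not_X_zero_dvd_pow _) ?_
    rw [add_comm]
    exact not_X_zero_dvd_add ⟨((M + 2 : ℕ) : S) * X 0 ^ κ, by ring⟩
      (not_X_zero_dvd_natCast_mul (by omega) (not_X_zero_dvd_pow _))

theorem pencilData_D'' (κ : ℕ) :
    PencilData (D'' (κ + 4)) (κ + 1) 1 (((κ + 2 : ℕ) : S) * X 3)
      (((κ + 4 : ℕ) : S) * X 1 ^ (κ + 2)) := by
  have hX : ∀ i, (X i : S).IsHomogeneous 1 := isHomogeneous_X ℂ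
  have hD : D'' (κ + 4) = X 0 ^ (κ + 3) * X 2 + X 1 ^ (κ + 4) + X 0 ^ (κ + 2) * X 1 * X 3 := rfl
  rw [hD]
  refine ⟨?_, ?_, ?_, ?_, ?_, ?_⟩
  · refine IsHomogeneous.add (IsHomogeneous.add ?_ ?_) ?_
    · exact isHomogeneous_of_eq (((hX 0).pow (κ + 3)).mul (hX 2)) rfl (by omega)
    · exact isHomogeneous_of_eq ((hX 1).pow (κ + 4)) rfl (by omega)
    · exact isHomogeneous_of_eq ((((hX 0).pow (κ + 2)).mul (hX 1)).mul (hX 3)) rfl (by omega)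
  · simp [pderiv_X]
    ring
  · simp [pderiv_X]
    ring
  · simp [pderiv_X]
  · simp [pderiv_X]
  · exact not_X_zero_dvd_natCast_mul (by omega) (not_X_zero_dvd_pow _)

theorem isNearlyFreeWithExponents_D'' (κ : ℕ) :
    IsNearlyFreeWithExponents (D'' (κ + 4)) 1 1 (κ + 2) :=
  (pencilData_D'' κ).isNearlyFree_of_monomial

theorem isFreeWithExponents_pencilSurface (M j : ℕ) :
    IsFreeWithExponents (pencilSurface (M + 2 + j) (M + 1)) ![1, M + 2, M + 2 + j] :=
  (pencilData_pencilSurface (M + 2 + j) (M + 1)).isFree_of_lt rfl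

theorem isNearlyFreeWithExponents_pencilSurface (κ ν : ℕ) :
    IsNearlyFreeWithExponents (pencilSurface κ (κ + ν + 2)) 1 (κ + 2) (κ + ν + 2) :=
  PencilData.isNearlyFree_of_gt (by omega) (by omega) (by omega) (by omega)
    (pencilData_pencilSurface κ (κ + ν + 2))

theorem isNearlyFreeWithExponents_pencilSurface_sub_one (κ : ℕ) :
    IsNearlyFreeWithExponents (pencilSurface (κ + 1) (κ + 2)) 1 (κ + 2) (κ + 3) := by
  set c : ℕ := (2 * κ + 6) * (2 * κ + 4) with hc
  set e : ℕ := (κ + 2) * (κ + 4) with he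
  have hc0 : c ≠ 0 := by positivity
  -- For k = m - 1 the second term of Q has order exactly x^(m-1), so it contributes the multiple of
  -- y in `W`. For k = m it has order x^m and goes into `V` instead.
  refine PencilData.isNearlyFree_of_eq (κ := κ + 1) (M := κ + 1) (n := 1)
    (W := (c : S) * X 3 - (e : S) * X 1) (V := 0) rfl ?_ ?_ ?_ (pencilData_pencilSurface _ _)
  · exact isHomogeneous_of_eq
      ((isHomogeneous_monomial_xyw c 0 0 1 (n := 1) (by omega)).sub
        (isHomogeneous_monomial_xyw e 0 1 0 (n := 1) (by omega))) (by simp) rfl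
  · simp only [map_sub, map_mul, map_natCast, evalXZero_X_three, evalXZero_X_one]
    rw [dvd_sub_left (Dvd.intro_left _ rfl)]
    exact not_X_one_dvd_natCast_mul hc0 not_X_one_dvd_X_three
  · simp only [hc, he, pencilP, pencilQ]
    push_cast
    ring

theorem isNearlyFreeWithExponents_pencilSurface_self (κ : ℕ) :
    IsNearlyFreeWithExponents (pencilSurface (κ + 1) (κ + 1)) 1 (κ + 2) (κ + 2) := by
  set c : ℕ := (2 * κ + 5) * (2 * κ + 3) with hc
  have hc0 : c ≠ 0 := by positivity
  refine PencilData.isNearlyFree_of_eq (κ := κ + 1) (M := κ) (n := 0)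
    (W := (c : S) * X 3) (V := -(((κ + 2) * (κ + 3) : ℕ) : S) * X 1 ^ (κ + 1)) rfl ?_ ?_ ?_
    (pencilData_pencilSurface _ _)
  · exact isHomogeneous_of_eq (isHomogeneous_monomial_xyw c 0 0 1 (n := 1) (by omega))
      (by simp) rfl
  · simp only [map_mul, map_natCast, evalXZero_X_three]
    exact not_X_one_dvd_natCast_mul hc0 not_X_one_dvd_X_three
  · simp only [hc, pencilP, pencilQ]
    push_cast
    ring

theorem D_eq_pencilSurface (M : ℕ) : D (M + 6) = pencilSurface 3 M := by
  have h1 : M + 6 - 1 = 3 + M + 2 := by omega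
  have h2 : M + 6 = 3 + M + 3 := by omega
  have h3 : M + 6 - 2 = 3 + M + 1 := by omega
  have h4 : M + 6 - 4 = M + 2 := by omega
  rw [D, pencilSurface, h1, h3, h4, h2]

theorem D'''_eq_pencilSurface (M : ℕ) : D''' (M + 3) = pencilSurface 0 M := by
  have h1 : M + 3 - 1 = 0 + M + 2 := by omega
  have h2 : M + 3 = 0 + M + 3 := by omega
  have h3 : M + 3 - 2 = 0 + M + 1 := by omega
  have h4 : 0 + M + 2 = M + 2 := by omega
  rw [D''', pencilSurface, h1, h3, h2, h4, zero_add 1, pow_one]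

theorem isFreeWithExponents_D_seven : IsFreeWithExponents (D 7) ![1, 2, 3] := by
  rw [D_eq_pencilSurface 1]
  exact isFreeWithExponents_pencilSurface 0 1

theorem isFreeWithExponents_D_eight : IsFreeWithExponents (D 8) ![1, 3, 3] := by
  rw [D_eq_pencilSurface 2]
  exact isFreeWithExponents_pencilSurface 1 0

theorem isNearlyFreeWithExponents_D_nine : IsNearlyFreeWithExponents (D 9) 1 4 4 := by
  rw [D_eq_pencilSurface 3]
  exact isNearlyFreeWithExponents_pencilSurface_self 2

theorem isNearlyFreeWithExponents_D_ten : IsNearlyFreeWithExponents (D 10) 1 4 5 := by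
  rw [D_eq_pencilSurface 4]
  exact isNearlyFreeWithExponents_pencilSurface_sub_one 2

theorem isNearlyFreeWithExponents_D (ν : ℕ) :
    IsNearlyFreeWithExponents (D (ν + 11)) 1 5 (ν + 5) := by
  rw [D_eq_pencilSurface (ν + 5)]
  have := isNearlyFreeWithExponents_pencilSurface 3 ν
  rwa [show 3 + ν + 2 = ν + 5 by omega] at this

theorem isNearlyFreeWithExponents_D'_seven : IsNearlyFreeWithExponents (D' 7) 1 3 3 :=
  isNearlyFreeWithExponents_pencilSurface 1 0

theorem isNearlyFreeWithExponents_D'_eight : IsNearlyFreeWithExponents (D' 8) 1 3 4 :=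
  isNearlyFreeWithExponents_pencilSurface_sub_one 1

theorem isFreeWithExponents_D' (j : ℕ) : IsFreeWithExponents (D' (j + 10)) ![1, 4, j + 4] := by
  have := isFreeWithExponents_pencilSurface 2 j
  rw [show 2 + 2 + j = j + 4 by omega] at this
  exact this

theorem isNearlyFreeWithExponents_D''' (ν : ℕ) :
    IsNearlyFreeWithExponents (D''' (ν + 5)) 1 2 (ν + 2) := by
  rw [D'''_eq_pencilSurface (ν + 2)]
  have := isNearlyFreeWithExponents_pencilSurface 0 ν
  rwa [zero_add, zero_add] at this

end SurfP3

namespace SurfP3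

/-! ### Homaloidal surfaces -/

/-- Lets the common factor of f_z and f_w be pulled out of the partial derivatives of `g` when the
gradient map is composed with its inverse. -/
theorem aeval_pair_mul {g : MvPolynomial (Fin 2) ℂ} {n : ℕ} (hg : g.IsHomogeneous n)
    (c u v : S) : aeval ![c * u, c * v] g = c ^ n * aeval ![u, v] g := by
  rw [aeval_def, aeval_def, eval₂_eq', eval₂_eq', Finset.mul_sum]
  refine Finset.sum_congr rfl fun s hs => ?_
  have hn : s 0 + s 1 = n := by
    have := hg.degree_eq_sum_deg_support hs
    rw [this, ← Fin.sum_univ_two (f := s)]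
    exact (Finset.sum_subset (Finset.subset_univ _) (by simp)).symm
  simp only [Fin.prod_univ_two, Matrix.cons_val_zero, Matrix.cons_val_one]
  rw [← hn]
  ring

theorem bind₁_aeval_pair (H : Fin 4 → S) (u v : S) (g : MvPolynomial (Fin 2) ℂ) :
    bind₁ H (aeval ![u, v] g) = aeval ![bind₁ H u, bind₁ H v] g := by
  rw [← AlgHom.comp_apply]
  congr 1
  ext i
  fin_cases i <;> simp

theorem isHomogeneous_aeval_pair {g : MvPolynomial (Fin 2) ℂ} {n : ℕ} (hg : g.IsHomogeneous n)
    (i j : Fin 4) : (aeval (![X i, X j] : Fin 2 → S) g).IsHomogeneous n := by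
  have := hg.aeval (![X i, X j] : Fin 2 → S) (n := 1) (fun l => by
    fin_cases l
    · exact isHomogeneous_X _ _
    · exact isHomogeneous_X _ _)
  rwa [one_mul] at this

theorem aeval_pair_eq_rename (g : MvPolynomial (Fin 2) ℂ) :
    aeval (![X 0, X 1] : Fin 2 → S) g = rename (![0, 1] : Fin 2 → Fin 4) g := by
  have h : aeval (![X 0, X 1] : Fin 2 → S) = rename (R := ℂ) (![0, 1] : Fin 2 → Fin 4) := by
    ext i
    fin_cases i <;> simp
  rw [h]

theorem injective_pair : Function.Injective (![0, 1] : Fin 2 → Fin 4) := by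
  decide

theorem pderiv_zero_aeval_pair (g : MvPolynomial (Fin 2) ℂ) :
    pderiv 0 (aeval (![X 0, X 1] : Fin 2 → S) g) = aeval ![X 0, X 1] (pderiv 0 g) := by
  rw [aeval_pair_eq_rename, aeval_pair_eq_rename]
  exact pderiv_rename injective_pair 0 g

theorem pderiv_one_aeval_pair (g : MvPolynomial (Fin 2) ℂ) :
    pderiv 1 (aeval (![X 0, X 1] : Fin 2 → S) g) = aeval ![X 0, X 1] (pderiv 1 g) := by
  rw [aeval_pair_eq_rename, aeval_pair_eq_rename]
  exact pderiv_rename injective_pair 1 g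

theorem notMem_vars_aeval_pair (g : MvPolynomial (Fin 2) ℂ) {i : Fin 4} (h0 : i ≠ 0)
    (h1 : i ≠ 1) : i ∉ (aeval (![X 0, X 1] : Fin 2 → S) g).vars := by
  classical
  rw [aeval_pair_eq_rename]
  intro h
  obtain ⟨j, -, hj⟩ := Finset.mem_image.1 (vars_rename _ _ h)
  fin_cases j
  · exact h0 hj.symm
  · exact h1 hj.symm

theorem isIdentityMap_of_eq_mul {F : Fin 4 → S} {c : S} (hc : c ≠ 0)
    (h : ∀ i, F i = c * X i) : IsIdentityMap F := by
  refine ⟨fun h0 => ?_, fun i j => ?_⟩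
  · have := congrFun h0 0
    rw [h 0] at this
    exact mul_ne_zero hc (X_ne_zero _) this
  · rw [h i, h j]
    ring

/-- A surface of degree `e + 3` which is linear in `z` and `w`. -/
noncomputable def ruledSurface (e : ℕ) (g : MvPolynomial (Fin 2) ℂ) : S :=
  X 0 ^ (e + 2) * X 2 + X 0 ^ (e + 1) * X 1 * X 3 + aeval ![X 0, X 1] g

variable {e : ℕ} {g : MvPolynomial (Fin 2) ℂ}

theorem isHomogeneous_ruledSurface (hg : g.IsHomogeneous (e + 3)) :
    (ruledSurface e g).IsHomogeneous (e + 3) := by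
  have hX : ∀ i, (X i : S).IsHomogeneous 1 := isHomogeneous_X ℂ
  refine IsHomogeneous.add (IsHomogeneous.add ?_ ?_) (isHomogeneous_aeval_pair hg 0 1)
  · exact isHomogeneous_of_eq (((hX 0).pow (e + 2)).mul (hX 2)) rfl (by omega)
  · exact isHomogeneous_of_eq ((((hX 0).pow (e + 1)).mul (hX 1)).mul (hX 3)) rfl (by omega)

theorem gradientMap_ruledSurface (e : ℕ) (g : MvPolynomial (Fin 2) ℂ) :
    gradientMap (ruledSurface e g) =
      ![((e + 2 : ℕ) : S) * X 0 ^ (e + 1) * X 2 + ((e + 1 : ℕ) : S) * X 0 ^ e * X 1 * X 3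
          + aeval ![X 0, X 1] (pderiv 0 g),
        X 0 ^ (e + 1) * X 3 + aeval ![X 0, X 1] (pderiv 1 g),
        X 0 ^ (e + 2), X 0 ^ (e + 1) * X 1] := by
  have h2 := pderiv_eq_zero_of_notMem_vars
    (notMem_vars_aeval_pair g (i := 2) (by decide) (by decide))
  have h3 := pderiv_eq_zero_of_notMem_vars
    (notMem_vars_aeval_pair g (i := 3) (by decide) (by decide))
  funext i
  fin_cases i
  · simp [-aeval_eq_bind₁, gradientMap, ruledSurface, pderiv_X, pderiv_zero_aeval_pair]
    ring
  · simp [-aeval_eq_bind₁, gradientMap, ruledSurface, pderiv_X, pderiv_one_aeval_pair]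
    ring
  · simp [-aeval_eq_bind₁, gradientMap, ruledSurface, pderiv_X, h2]
  · simp [-aeval_eq_bind₁, gradientMap, ruledSurface, pderiv_X, h3]

theorem isHomaloidal_ruledSurface (hg : g.IsHomogeneous (e + 3)) :
    IsHomaloidal (ruledSurface e g) := by
  have hX : ∀ i, (X i : S).IsHomogeneous 1 := isHomogeneous_X ℂ
  have hX0 : (X 0 : S) ≠ 0 := X_ne_zero _
  have hg0 : (pderiv 0 g).IsHomogeneous (e + 2) := hg.pderiv
  have hg1 : (pderiv 1 g).IsHomogeneous (e + 2) := hg.pderiv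
  set c : S := C (((e + 2 : ℕ) : ℂ)⁻¹) with hc
  have hce : c * ((e + 2 : ℕ) : S) = 1 := by
    have : ((e + 2 : ℕ) : S) = C ((e + 2 : ℕ) : ℂ) := (map_natCast C _).symm
    rw [this, hc, ← C_mul, inv_mul_cancel₀ (by exact_mod_cast Nat.succ_ne_zero (e + 1)), C_1]
  set B : S := X 1 * X 2 ^ (e + 1) - aeval ![X 2, X 3] (pderiv 1 g) with hB
  set A : S := X 0 * X 2 ^ (e + 2) - ((e + 1 : ℕ) : S) * X 3 * B
    - X 2 * aeval ![X 2, X 3] (pderiv 0 g) with hA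
  have hBhom : B.IsHomogeneous (e + 2) :=
    (isHomogeneous_of_eq ((hX 1).mul ((hX 2).pow (e + 1))) rfl (by omega)).sub
      (isHomogeneous_aeval_pair hg1 2 3)
  have hcast : (((e + 1 : ℕ) : S)).IsHomogeneous 0 := by
    simpa using isHomogeneous_C (Fin 4) ((e + 1 : ℕ) : ℂ)
  have hAhom : A.IsHomogeneous (e + 3) := by
    refine IsHomogeneous.sub (IsHomogeneous.sub ?_ ?_) ?_
    · exact isHomogeneous_of_eq ((hX 0).mul ((hX 2).pow (e + 2))) rfl (by omega)
    · exact isHomogeneous_of_eq ((hcast.mul (hX 3)).mul hBhom) rfl (by omega)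
    · exact isHomogeneous_of_eq ((hX 2).mul (isHomogeneous_aeval_pair hg0 2 3)) rfl (by omega)
  rw [IsHomaloidal, gradientMap_ruledSurface]
  set F : Fin 4 → S := ![((e + 2 : ℕ) : S) * X 0 ^ (e + 1) * X 2
      + ((e + 1 : ℕ) : S) * X 0 ^ e * X 1 * X 3 + aeval ![X 0, X 1] (pderiv 0 g),
    X 0 ^ (e + 1) * X 3 + aeval ![X 0, X 1] (pderiv 1 g),
    X 0 ^ (e + 2), X 0 ^ (e + 1) * X 1] with hF
  -- The preimage after multiplication by X₂^(e+2).
  set G : Fin 4 → S := ![X 2 ^ (e + 3), X 3 * X 2 ^ (e + 2), c * A, X 2 * B]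
  have hF2 : F 2 = X 0 ^ (e + 1) * X 0 := by rw [← pow_succ]; rfl
  have hF3 : F 3 = X 0 ^ (e + 1) * X 1 := rfl
  have hG0 : G 0 = X 2 ^ (e + 2) * X 2 := by rw [← pow_succ]; rfl
  have hG1 : G 1 = X 2 ^ (e + 2) * X 3 := by rw [mul_comm]; rfl
  have hbF : ∀ i, bind₁ F (X i) = F i := bind₁_X_right F
  have hbG : ∀ i, bind₁ G (X i) = G i := bind₁_X_right G
  have hBF : bind₁ F B = X 0 ^ ((e + 1) * (e + 3)) * X 3 := by
    rw [hB, map_sub, map_mul, map_pow, hbF, hbF, bind₁_aeval_pair, hbF, hbF, hF2, hF3,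
      aeval_pair_mul hg1, hF]
    simp only [Matrix.cons_val_one, Matrix.cons_val_zero]
    ring
  have hAF : c * bind₁ F A = X 0 ^ ((e + 1) * (e + 4) + 1) * X 2 := by
    have : bind₁ F A = ((e + 2 : ℕ) : S) * (X 0 ^ ((e + 1) * (e + 4) + 1) * X 2) := by
      rw [hA, map_sub, map_sub, map_mul, map_mul, map_mul, map_mul, map_pow, map_natCast, hbF,
        hbF, hbF, hBF, bind₁_aeval_pair, hbF, hbF, hF2, hF3, aeval_pair_mul hg0, hF]
      simp only [Matrix.cons_val_zero]
      ring
    rw [this, ← mul_assoc, hce, one_mul]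
  refine ⟨⟨fun h0 => ?_, e + 2, ?_⟩, G, ⟨fun h0 => ?_, e + 3, ?_⟩,
    isIdentityMap_of_eq_mul (c := X 0 ^ ((e + 1) * (e + 4) + 1)) (pow_ne_zero _ hX0) ?_,
    isIdentityMap_of_eq_mul (c := X 2 ^ ((e + 1) * (e + 4) + 1))
      (pow_ne_zero _ (X_ne_zero _)) ?_⟩
  · exact pow_ne_zero _ hX0 (congrFun h0 2)
  · intro i
    rw [hF, ← gradientMap_ruledSurface]
    exact (isHomogeneous_ruledSurface hg).pderiv
  · exact pow_ne_zero _ (X_ne_zero _) (congrFun h0 0)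
  · intro i
    fin_cases i
    · exact isHomogeneous_X_pow _ _
    · exact isHomogeneous_of_eq ((hX 3).mul ((hX 2).pow (e + 2))) rfl (by omega)
    · exact hAhom.C_mul _
    · exact isHomogeneous_of_eq ((hX 2).mul hBhom) rfl (by omega)
  · intro i
    fin_cases i
    · change bind₁ F (X 2 ^ (e + 3)) = _
      rw [map_pow, hbF, hF2]
      simp only [Fin.zero_eta]
      ring
    · change bind₁ F (X 3 * X 2 ^ (e + 2)) = _
      rw [map_mul, map_pow, hbF, hbF, hF2, hF3]
      simp only [Fin.mk_one]
      ring
    · change bind₁ F (c * A) = _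
      rw [map_mul, hc, bind₁_C_right, ← hc, hAF]
      rfl
    · change bind₁ F (X 2 * B) = _
      rw [map_mul, hbF, hBF, hF2]
      change _ = _ * X 3
      ring
  · intro i
    fin_cases i
    · change bind₁ G (((e + 2 : ℕ) : S) * X 0 ^ (e + 1) * X 2
        + ((e + 1 : ℕ) : S) * X 0 ^ e * X 1 * X 3 + aeval ![X 0, X 1] (pderiv 0 g)) = _ * X 0
      rw [map_add, map_add, map_mul, map_mul, map_mul, map_mul, map_mul, map_pow, map_pow,
        map_natCast, map_natCast, hbG, hbG, hbG, hbG, bind₁_aeval_pair, hbG, hbG, hG0, hG1,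
        aeval_pair_mul hg0]
      change ((e + 2 : ℕ) : S) * (X 2 ^ (e + 2) * X 2) ^ (e + 1) * (c * A)
        + ((e + 1 : ℕ) : S) * (X 2 ^ (e + 2) * X 2) ^ e * (X 2 ^ (e + 2) * X 3) * (X 2 * B) + _ = _
      have h1 : ((e + 2 : ℕ) : S) * (X 2 ^ (e + 2) * X 2) ^ (e + 1) * (c * A)
          = (X 2 ^ (e + 2) * X 2) ^ (e + 1) * A := by
        linear_combination (X 2 ^ (e + 2) * X 2) ^ (e + 1) * A * hce
      rw [h1, hA]
      ring
    · change bind₁ G (X 0 ^ (e + 1) * X 3 + aeval ![X 0, X 1] (pderiv 1 g)) = _ * X 1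
      rw [map_add, map_mul, map_pow, hbG, hbG, bind₁_aeval_pair, hbG, hbG, hG0, hG1,
        aeval_pair_mul hg1]
      change (X 2 ^ (e + 2) * X 2) ^ (e + 1) * (X 2 * B) + _ = _
      rw [hB]
      ring
    · change bind₁ G (X 0 ^ (e + 2)) = _ * X 2
      rw [map_pow, hbG, hG0]
      ring
    · change bind₁ G (X 0 ^ (e + 1) * X 1) = _ * X 3
      rw [map_mul, map_pow, hbG, hbG, hG0, hG1]
      ring

theorem irreducible_ruledSurface (hg : eval ![0, 1] g ≠ 0) : Irreducible (ruledSurface e g) := by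
  classical
  have hx : ¬ (X 0 : S) ∣ X 0 ^ (e + 1) * X 1 * X 3 + aeval ![X 0, X 1] g := by
    rintro ⟨q, hq⟩
    have h := congrArg (eval ![0, 1, 0, 0]) hq
    have h1 : eval (![0, 1, 0, 0] : Fin 4 → ℂ) (aeval (![X 0, X 1] : Fin 2 → S) g)
        = eval ![0, 1] g := by
      rw [aeval_pair_eq_rename, eval_rename]
      congr 2
      funext i
      fin_cases i <;> rfl
    simp [-aeval_eq_bind₁, h1] at h
    exact hg h
  have hvars : ∀ n : ℕ, (2 : Fin 4) ∉ (X 0 ^ n : S).vars := by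
    intro n h
    have := vars_pow (X 0 : S) n h
    simp [vars_X] at this
  have h := irreducible_mul_X_add (X 0 ^ (e + 2) : S)
    (X 0 ^ (e + 1) * X 1 * X 3 + aeval ![X 0, X 1] g) 2 (pow_ne_zero _ (X_ne_zero _)) (hvars _)
    ?_ ?_
  · rwa [← add_assoc] at h
  · intro h
    rcases Finset.mem_union.1 (vars_add_subset _ _ h) with h | h
    · rcases Finset.mem_union.1 (vars_mul _ _ h) with h | h
      · rcases Finset.mem_union.1 (vars_mul _ _ h) with h | h
        · exact hvars _ h
        · simp [vars_X] at h
      · simp [vars_X] at h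
    · exact notMem_vars_aeval_pair g (by decide) (by decide) h
  · exact ((prime_X_zero.irreducible.isRelPrime_iff_not_dvd).2 hx).pow_left

theorem isIrreducibleHomaloidal_ruledSurface (hg : g.IsHomogeneous (e + 3))
    (hg1 : eval ![0, 1] g ≠ 0) : IsIrreducibleHomaloidal (e + 3) (ruledSurface e g) :=
  ⟨isHomogeneous_ruledSurface hg, irreducible_ruledSurface hg1, isHomaloidal_ruledSurface hg⟩

theorem isIrreducibleHomaloidal_of_eq {f : S} (hg : g.IsHomogeneous (e + 3))
    (hg1 : eval ![0, 1] g ≠ 0) (hf : f = ruledSurface e g) :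
    IsIrreducibleHomaloidal (e + 3) f :=
  hf ▸ isIrreducibleHomaloidal_ruledSurface hg hg1

theorem isHomogeneous_X_pow_mul_X_pow {i j n : ℕ} (h : i + j = n) :
    (X 0 ^ i * X 1 ^ j : MvPolynomial (Fin 2) ℂ).IsHomogeneous n := by
  have := (isHomogeneous_X_pow (R := ℂ) (0 : Fin 2) i).mul
    (isHomogeneous_X_pow (R := ℂ) (1 : Fin 2) j)
  rwa [h] at this

theorem isIrreducibleHomaloidal_D {d : ℕ} (hd : 4 ≤ d) : IsIrreducibleHomaloidal d (D d) := by
  obtain ⟨e, rfl⟩ : ∃ e, d = e + 1 + 3 := ⟨d - 4, by omega⟩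
  refine isIrreducibleHomaloidal_of_eq (g := X 1 ^ (e + 1 + 3) + X 0 ^ 4 * X 1 ^ e)
    ((isHomogeneous_X_pow _ _).add (isHomogeneous_X_pow_mul_X_pow (by omega))) (by simp) ?_
  have h1 : D (e + 1 + 3) = X 0 ^ (e + 3) * X 2 + X 1 ^ (e + 1 + 3) + X 0 ^ (e + 2) * X 1 * X 3
    + X 0 ^ 4 * X 1 ^ e := rfl
  rw [h1, ruledSurface]
  simp
  ring

theorem isIrreducibleHomaloidal_D' {d : ℕ} (hd : 5 ≤ d) : IsIrreducibleHomaloidal d (D' d) := by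
  obtain ⟨e, rfl⟩ : ∃ e, d = e + 2 + 3 := ⟨d - 5, by omega⟩
  refine isIrreducibleHomaloidal_of_eq (g := X 1 ^ (e + 2 + 3) + X 0 ^ e * X 1 ^ 5)
    ((isHomogeneous_X_pow _ _).add (isHomogeneous_X_pow_mul_X_pow (by omega))) ?_ ?_
  -- For degree 5 both terms are y^5 and the value is 2; otherwise the second term vanishes at x =
  -- 0.
  · rcases e with _ | e <;> simp
  have h1 : D' (e + 2 + 3) = X 0 ^ (e + 4) * X 2 + X 1 ^ (e + 2 + 3) + X 0 ^ (e + 3) * X 1 * X 3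
    + X 0 ^ e * X 1 ^ 5 := rfl
  rw [h1, ruledSurface]
  simp
  ring

theorem isIrreducibleHomaloidal_D'' {d : ℕ} (hd : 4 ≤ d) :
    IsIrreducibleHomaloidal d (D'' d) := by
  obtain ⟨e, rfl⟩ : ∃ e, d = e + 1 + 3 := ⟨d - 4, by omega⟩
  refine isIrreducibleHomaloidal_of_eq (g := X 1 ^ (e + 1 + 3)) (isHomogeneous_X_pow _ _)
    (by simp) ?_
  have h1 : D'' (e + 1 + 3) = X 0 ^ (e + 3) * X 2 + X 1 ^ (e + 1 + 3)
    + X 0 ^ (e + 2) * X 1 * X 3 := rfl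
  rw [h1, ruledSurface]
  simp
  ring

theorem isIrreducibleHomaloidal_D''' {d : ℕ} (hd : 5 ≤ d) :
    IsIrreducibleHomaloidal d (D''' d) := by
  obtain ⟨e, rfl⟩ : ∃ e, d = e + 2 + 3 := ⟨d - 5, by omega⟩
  refine isIrreducibleHomaloidal_of_eq (g := X 1 ^ (e + 2 + 3) + X 0 ^ 1 * X 1 ^ (e + 4))
    ((isHomogeneous_X_pow _ _).add (isHomogeneous_X_pow_mul_X_pow (by omega))) (by simp) ?_
  have h1 : D''' (e + 2 + 3) = X 0 ^ (e + 4) * X 2 + X 1 ^ (e + 2 + 3)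
    + X 0 ^ (e + 3) * X 1 * X 3 + X 0 * X 1 ^ (e + 4) := rfl
  rw [h1, ruledSurface]
  simp
  ring

end SurfP3

namespace SurfP3

/-! ### The discriminant of the binary cubic form -/

theorem isHomogeneous_Delta3 : Delta3.IsHomogeneous 4 := by
  have hX : ∀ i, (X i : S).IsHomogeneous 1 := isHomogeneous_X ℂ
  have hc : ∀ n : ℕ, ((n : S)).IsHomogeneous 0 := fun n => by
    simpa using isHomogeneous_C (Fin 4) (n : ℂ)
  have h := (((((hX 1).pow 2).mul ((hX 2).pow 2)).sub
    (((hc 4).mul (hX 0)).mul ((hX 2).pow 3))).sub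
    (((hc 4).mul ((hX 1).pow 3)).mul (hX 3))).add
    (((((hc 18).mul (hX 0)).mul (hX 1)).mul (hX 2)).mul (hX 3)) |>.sub
    (((hc 27).mul ((hX 0).pow 2)).mul ((hX 3).pow 2))
  exact h

theorem gradientMap_Delta3 : gradientMap Delta3 =
    ![-4 * X 2 ^ 3 + 18 * X 1 * X 2 * X 3 - 54 * X 0 * X 3 ^ 2,
      2 * X 1 * X 2 ^ 2 - 12 * X 1 ^ 2 * X 3 + 18 * X 0 * X 2 * X 3,
      2 * X 1 ^ 2 * X 2 - 12 * X 0 * X 2 ^ 2 + 18 * X 0 * X 1 * X 3,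
      -4 * X 1 ^ 3 + 18 * X 0 * X 1 * X 2 - 54 * X 0 ^ 2 * X 3] := by
  have h : ∀ (n : ℕ) [n.AtLeastTwo] (i : Fin 4), pderiv i (OfNat.ofNat n : S) = 0 := by
    intro n _ i
    have := (pderiv (R := ℂ) i).map_natCast n
    exact this
  funext i
  fin_cases i
  · simp [gradientMap, Delta3, pderiv_X, h]
    ring
  · simp [gradientMap, Delta3, pderiv_X, h]
    ring
  · simp [gradientMap, Delta3, pderiv_X, h]
    ring
  · simp [gradientMap, Delta3, pderiv_X, h]
    ring

theorem Delta3_ne_zero : Delta3 ≠ 0 := by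
  intro h
  have := congrArg (eval ![1, 0, 0, 1]) h
  simp [Delta3] at this

theorem isHomaloidal_Delta3 : IsHomaloidal Delta3 := by
  have hX : ∀ i, (X i : S).IsHomogeneous 1 := isHomogeneous_X ℂ
  rw [IsHomaloidal]
  have hF := gradientMap_Delta3
  have hFhom : ∀ i, (gradientMap Delta3 i).IsHomogeneous 3 :=
    fun i => isHomogeneous_Delta3.pderiv
  generalize gradientMap Delta3 = F at hF hFhom
  have hF0 : F ≠ 0 := by
    intro h0
    have := congrArg (eval ![0, 1, 0, 0]) (congrFun h0 3)
    simp [hF] at this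
  -- Up to sign, the identification of the dual space with binary cubics by the invariant symplectic
  -- form. As a map, `L ∘ F` is the cubic covariant, whose square is a constant times Δ² times the
  -- identity; hence `L ∘ F ∘ L` inverts the gradient map `F`.
  let L : Fin 4 → S := ![X 3, -3 * X 2, 3 * X 1, -X 0]
  have hLhom : ∀ i, (L i).IsHomogeneous 1 := by
    have h3 : (3 : S).IsHomogeneous 0 := isHomogeneous_C (Fin 4) (3 : ℂ)
    intro i
    fin_cases i
    · exact hX 3
    · exact h3.neg.mul (hX 2)
    · exact h3.mul (hX 1)
    · exact (hX 0).neg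
  let G : Fin 4 → S := ![bind₁ L (F 3), -3 * bind₁ L (F 2), 3 * bind₁ L (F 1), -bind₁ L (F 0)]
  have hLF : ∀ i, (bind₁ L (F i)).IsHomogeneous 3 := by
    intro i
    have := (hFhom i).aeval L hLhom
    rwa [one_mul] at this
  have hGhom : ∀ i, (G i).IsHomogeneous 3 := by
    have h3 : (3 : S).IsHomogeneous 0 := isHomogeneous_C (Fin 4) (3 : ℂ)
    intro i
    fin_cases i
    · exact hLF 3
    · exact isHomogeneous_of_eq (h3.neg.mul (hLF 2)) rfl rfl
    · exact isHomogeneous_of_eq (h3.mul (hLF 1)) rfl rfl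
    · exact (hLF 0).neg
  have hG0 : G ≠ 0 := by
    intro h0
    have := congrArg (eval ![0, 0, 1, 0]) (congrFun h0 0)
    simp [G, hF, L, map_ofNat] at this
  have h4 : ∀ H : Fin 4 → S, ∀ n : ℕ, [n.AtLeastTwo] → bind₁ H (OfNat.ofNat n : S) =
      OfNat.ofNat n := fun H n _ => map_ofNat (bind₁ H) n
  refine ⟨⟨hF0, 3, hFhom⟩, G, ⟨hG0, 3, hGhom⟩,
    isIdentityMap_of_eq_mul (c := -11664 * Delta3 ^ 2) ?_ ?_,
    isIdentityMap_of_eq_mul (c := -11664 * bind₁ L Delta3 ^ 2) ?_ ?_⟩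
  · exact mul_ne_zero (by norm_num) (pow_ne_zero _ Delta3_ne_zero)
  · intro i
    fin_cases i <;>
    · simp [comp, G, L, hF, Delta3, h4]
      ring
  · refine mul_ne_zero (by norm_num) (pow_ne_zero _ fun h => ?_)
    have := congrArg (eval ![1, 0, 0, 1]) h
    simp [Delta3, L, h4] at this
  · intro i
    fin_cases i <;>
    · simp [comp, G, L, hF, Delta3, h4]
      ring

/-- A constant factor divides both `a` and `b`, so it is a unit. Two linear factors would make the
discriminant the square of their resultant. -/
theorem irreducible_quadratic {R : Type*} [CommRing R] [IsDomain R] {a b c : R} (ha : a ≠ 0)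
    (hab : IsRelPrime a b) (hdisc : ∀ s, b ^ 2 - 4 * a * c ≠ s ^ 2) :
    Irreducible (Polynomial.C a * Polynomial.X ^ 2 + Polynomial.C b * Polynomial.X
      + Polynomial.C c) := by
  set p : Polynomial R := Polynomial.C a * Polynomial.X ^ 2 + Polynomial.C b * Polynomial.X
    + Polynomial.C c with hp
  have hdeg : p.natDegree = 2 := Polynomial.natDegree_quadratic ha
  have hp0 : p ≠ 0 := fun h => by simp [h] at hdeg
  have hco : ∀ a b c : R,
      let q := Polynomial.C a * Polynomial.X ^ 2 + Polynomial.C b * Polynomial.X + Polynomial.C c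
      q.coeff 2 = a ∧ q.coeff 1 = b ∧ q.coeff 0 = c := by
    intro a b c
    refine ⟨?_, ?_, ?_⟩
    · simp
    · simp
    · simp
  have c2 : p.coeff 2 = a := (hco a b c).1
  have c1 : p.coeff 1 = b := (hco a b c).2.1
  have c0 : p.coeff 0 = c := (hco a b c).2.2
  have hconst : ∀ P Q : Polynomial R, p = P * Q → P.natDegree = 0 → IsUnit P := by
    intro P Q hPQ hP
    rw [Polynomial.eq_C_of_natDegree_eq_zero hP] at hPQ ⊢
    refine (hab ⟨Q.coeff 2, ?_⟩ ⟨Q.coeff 1, ?_⟩).map Polynomial.C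
    · rw [← c2, hPQ, Polynomial.coeff_C_mul]
    · rw [← c1, hPQ, Polynomial.coeff_C_mul]
  refine ⟨fun hu => ?_, fun P Q hPQ => ?_⟩
  · rw [Polynomial.natDegree_eq_zero_of_isUnit hu] at hdeg
    omega
  · have hP0 : P ≠ 0 := fun h => hp0 (by rw [hPQ, h, zero_mul])
    have hQ0 : Q ≠ 0 := fun h => hp0 (by rw [hPQ, h, mul_zero])
    have hsum : P.natDegree + Q.natDegree = 2 := by
      rw [← hdeg, hPQ, Polynomial.natDegree_mul hP0 hQ0]
    by_cases hP : P.natDegree = 0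
    · exact Or.inl (hconst P Q hPQ hP)
    by_cases hQ : Q.natDegree = 0
    · exact Or.inr (hconst Q P (by rw [hPQ, mul_comm]) hQ)
    exfalso
    obtain ⟨p₁, p₀, rfl⟩ := Polynomial.exists_eq_X_add_C_of_natDegree_le_one
      (show P.natDegree ≤ 1 by omega)
    obtain ⟨q₁, q₀, rfl⟩ := Polynomial.exists_eq_X_add_C_of_natDegree_le_one
      (show Q.natDegree ≤ 1 by omega)
    have hexp : p = Polynomial.C (p₁ * q₁) * Polynomial.X ^ 2
        + Polynomial.C (p₁ * q₀ + p₀ * q₁) * Polynomial.X + Polynomial.C (p₀ * q₀) := by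
      rw [hPQ]
      simp only [Polynomial.C_mul, Polynomial.C_add]
      ring
    obtain ⟨h2, h1, h0⟩ := hco (p₁ * q₁) (p₁ * q₀ + p₀ * q₁) (p₀ * q₀)
    rw [← hexp] at h0 h1 h2
    refine hdisc (p₁ * q₀ - p₀ * q₁) ?_
    rw [← c0, ← c1, ← c2, h0, h1, h2]
    ring

theorem irreducible_Delta3 : Irreducible Delta3 := by
  let R := MvPolynomial (Fin 3) ℂ
  have hw : Prime (X 2 : R) := X_prime
  -- `Delta3` as a quadratic in x over ℂ[y, z, w]; the variables of `R` are y, z, w in this order.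
  have h := irreducible_quadratic (R := R) (a := -27 * X 2 ^ 2)
    (b := 18 * X 0 * X 1 * X 2 - 4 * X 1 ^ 3) (c := X 0 ^ 2 * X 1 ^ 2 - 4 * X 0 ^ 3 * X 2)
    (mul_ne_zero (by norm_num) (pow_ne_zero _ (X_ne_zero _))) ?_ ?_
  · have e : finSuccEquiv ℂ 3 Delta3 = Polynomial.C (-27 * X 2 ^ 2) * Polynomial.X ^ 2
        + Polynomial.C (18 * X 0 * X 1 * X 2 - 4 * X 1 ^ 3) * Polynomial.X
        + Polynomial.C (X 0 ^ 2 * X 1 ^ 2 - 4 * X 0 ^ 3 * X 2) := by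
      have h1 : finSuccEquiv ℂ 3 (X 1) = Polynomial.C (X 0) := finSuccEquiv_X_succ (j := 0)
      have h2 : finSuccEquiv ℂ 3 (X 2) = Polynomial.C (X 1) := finSuccEquiv_X_succ (j := 1)
      have h3 : finSuccEquiv ℂ 3 (X 3) = Polynomial.C (X 2) := finSuccEquiv_X_succ (j := 2)
      simp only [Delta3, map_add, map_sub, map_mul, map_pow, map_ofNat, finSuccEquiv_X_zero,
        h1, h2, h3, map_neg]
      ring
    rw [← e] at h
    exact (MulEquiv.irreducible_iff (finSuccEquiv ℂ 3)).1 h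
  · have h27 : IsUnit (-27 : R) := by
      have := (isUnit_iff_ne_zero.2 (by norm_num : (-27 : ℂ) ≠ 0)).map (C (σ := Fin 3))
      rwa [map_neg, map_ofNat] at this
    have hnd : ¬ (X 2 : R) ∣ 18 * X 0 * X 1 * X 2 - 4 * X 1 ^ 3 := by
      rintro ⟨q, hq⟩
      have := congrArg (eval ![0, 1, 0]) hq
      simp at this
    rw [isRelPrime_mul_unit_left_left h27]
    exact ((hw.irreducible.isRelPrime_iff_not_dvd).2 hnd).pow_left
  · intro s hs
    -- At (y, z, w) = (T, 0, 1) the discriminant becomes -432 T³, of odd degree.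
    have := congrArg (aeval ![(Polynomial.X : Polynomial ℂ), 0, 1]) hs
    simp only [map_sub, map_pow, map_mul, aeval_X, map_neg, map_ofNat, Matrix.cons_val] at this
    have h3 : (aeval ![(Polynomial.X : Polynomial ℂ), 0, 1] s) ^ 2
        = Polynomial.C (-432) * Polynomial.X ^ 3 := by
      rw [← this]
      simp only [map_neg, map_ofNat]
      ring
    have := congrArg Polynomial.natDegree h3
    rw [Polynomial.natDegree_pow, Polynomial.natDegree_C_mul_X_pow _ _ (by norm_num)] at this
    omega

theorem isIrreducibleHomaloidal_Delta3 : IsIrreducibleHomaloidal 4 Delta3 :=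
  ⟨isHomogeneous_Delta3, irreducible_Delta3, isHomaloidal_Delta3⟩

/-! ### A criterion for freeness -/

/-- The minor with columns `i`, `j`, `k`. -/
noncomputable def minorThree (a b c : Fin 4 → S) (i j k : Fin 4) : S :=
  a i * (b j * c k - b k * c j) - a j * (b i * c k - b k * c i) + a k * (b i * c j - b j * c i)

/-- The determinant of the matrix with rows `a`, `b`, `c`, `d`. -/
noncomputable def detFour (a b c d : Fin 4 → S) : S :=
  a 0 * minorThree b c d 1 2 3 - a 1 * minorThree b c d 0 2 3 + a 2 * minorThree b c d 0 1 3
    - a 3 * minorThree b c d 0 1 2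

/-- Cramer's rule, used to expand a syzygy in terms of the Euler field and three given syzygies. -/
theorem detFour_mul_apply (e a b c v : Fin 4 → S) (j : Fin 4) :
    detFour e a b c * v j = detFour v a b c * e j + detFour e v b c * a j
      + detFour e a v c * b j + detFour e a b v * c j := by
  fin_cases j
  · simp [detFour, minorThree]
    ring
  · simp [detFour, minorThree]
    ring
  · simp [detFour, minorThree]
    ring
  · simp [detFour, minorThree]
    ring

/-- Column operations replace the last column by the products of the rows with `F`. When `F` is the
gradient, rows that are syzygies contribute zero. -/
theorem detFour_mul_last (e a b c F : Fin 4 → S) :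
    detFour e a b c * F 3 =
      -((e 0 * F 0 + e 1 * F 1 + e 2 * F 2 + e 3 * F 3) * minorThree a b c 0 1 2)
      + (a 0 * F 0 + a 1 * F 1 + a 2 * F 2 + a 3 * F 3) * minorThree e b c 0 1 2
      - (b 0 * F 0 + b 1 * F 1 + b 2 * F 2 + b 3 * F 3) * minorThree e a c 0 1 2
      + (c 0 * F 0 + c 1 * F 1 + c 2 * F 2 + c 3 * F 3) * minorThree e a b 0 1 2 := by
  simp only [detFour, minorThree]
  ring

/-- Saito's criterion for an irreducible surface. -/
theorem isFreeWithExponents_of_detFour {f : S} {d : ℕ} (hf : f.IsHomogeneous d)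
    (hirr : Irreducible f) (hnd : ¬ f ∣ pderiv 3 f) {e : Fin 3 → ℕ} (he : Monotone e)
    (v : Fin 3 → Fin 4 → S) (hv : ∀ i, v i ∈ AR f) (hvh : ∀ i, IsHomogeneousVec (e i) (v i))
    {c : ℂ} (hdet : C c * detFour X (v 0) (v 1) (v 2) = f) :
    IsFreeWithExponents f e := by
  have hf3 : pderiv 3 f ≠ 0 := fun h => hnd (h ▸ dvd_zero f)
  have hEuler : (X 0 * pderiv 0 f + X 1 * pderiv 1 f + X 2 * pderiv 2 f + X 3 * pderiv 3 f : S)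
      = (d : S) * f := by
    have := hf.sum_X_mul_pderiv
    rw [Fin.sum_univ_four, nsmul_eq_mul] at this
    exact this
  have hdet0 : detFour X (v 0) (v 1) (v 2) ≠ 0 := by
    intro h
    rw [h, mul_zero] at hdet
    exact hirr.ne_zero hdet.symm
  -- Only the Euler row survives in the last column, and its entry is d·f; so f divides f_w times
  -- the determinant, hence the determinant. These quotients are the Cramer coefficients of an
  -- arbitrary syzygy, and by `hzero` the Euler field has coefficient zero.
  have hdvd : ∀ a ∈ AR f, ∀ b ∈ AR f, ∀ u ∈ AR f, f ∣ detFour X a b u := by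
    intro a ha b hb u hu
    rw [mem_AR] at ha hb hu
    refine (hirr.prime.dvd_or_dvd (b := pderiv 3 f) ?_).resolve_right hnd
    rw [detFour_mul_last X a b u (fun i => pderiv i f), ha, hb, hu, hEuler]
    exact ⟨-(d * minorThree a b u 0 1 2), by ring⟩
  have hzero : ∀ a ∈ AR f, detFour a (v 0) (v 1) (v 2) = 0 := by
    intro a ha
    have h0 := hv 0
    have h1 := hv 1
    have h2 := hv 2
    rw [mem_AR] at ha h0 h1 h2
    have h : detFour a (v 0) (v 1) (v 2) * pderiv 3 f = 0 := by
      rw [detFour_mul_last a (v 0) (v 1) (v 2) (fun i => pderiv i f), ha, h0, h1, h2]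
      ring
    exact (mul_eq_zero.1 h).resolve_right hf3
  let ρ : Fin 3 → AR f := fun i => ⟨v i, hv i⟩
  have hli : LinearIndependent S ρ := by
    rw [Fintype.linearIndependent_iff]
    intro r hr
    have hr' : ∑ i, r i • v i = 0 := by
      have := congrArg (AR f).subtype hr
      rw [map_sum] at this
      exact this
    have h : ∀ j, r 0 * v 0 j + r 1 * v 1 j + r 2 * v 2 j = 0 := by
      intro j
      have := congrFun hr' j
      simpa [Fin.sum_univ_three] using this
    have k0 : detFour X (v 0) (v 1) (v 2) * r 0 = 0 := by
      have : detFour X (v 0) (v 1) (v 2) * r 0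
          = detFour X (fun j => r 0 * v 0 j + r 1 * v 1 j + r 2 * v 2 j) (v 1) (v 2) := by
        simp only [detFour, minorThree]
        ring
      rw [this]
      simp [h, detFour, minorThree]
    have k1 : detFour X (v 0) (v 1) (v 2) * r 1 = 0 := by
      have : detFour X (v 0) (v 1) (v 2) * r 1
          = detFour X (v 0) (fun j => r 0 * v 0 j + r 1 * v 1 j + r 2 * v 2 j) (v 2) := by
        simp only [detFour, minorThree]
        ring
      rw [this]
      simp [h, detFour, minorThree]
    have k2 : detFour X (v 0) (v 1) (v 2) * r 2 = 0 := by
      have : detFour X (v 0) (v 1) (v 2) * r 2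
          = detFour X (v 0) (v 1) (fun j => r 0 * v 0 j + r 1 * v 1 j + r 2 * v 2 j) := by
        simp only [detFour, minorThree]
        ring
      rw [this]
      simp [h, detFour, minorThree]
    intro i
    fin_cases i
    · exact (mul_eq_zero.1 k0).resolve_left hdet0
    · exact (mul_eq_zero.1 k1).resolve_left hdet0
    · exact (mul_eq_zero.1 k2).resolve_left hdet0
  have hspan : ⊤ ≤ Submodule.span S (Set.range ρ) := by
    rintro ⟨a, ha⟩ -
    obtain ⟨q₀, h₀⟩ := hdvd a ha _ (hv 1) _ (hv 2)
    obtain ⟨q₁, h₁⟩ := hdvd _ (hv 0) a ha _ (hv 2)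
    obtain ⟨q₂, h₂⟩ := hdvd _ (hv 0) _ (hv 1) a ha
    rw [Submodule.mem_span_range_iff_exists_fun]
    refine ⟨![C c * q₀, C c * q₁, C c * q₂], Subtype.ext (funext fun j => ?_)⟩
    have hcr := detFour_mul_apply X (v 0) (v 1) (v 2) a j
    rw [hzero a ha, h₀, h₁, h₂] at hcr
    have hgoal : f * a j = f * (C c * q₀ * v 0 j + C c * q₁ * v 1 j + C c * q₂ * v 2 j) := by
      linear_combination C c * hcr - a j * hdet
    have := mul_left_cancel₀ hirr.ne_zero hgoal
    simp [Fin.sum_univ_three, ρ, this]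
  refine ⟨he, Module.Basis.mk hli hspan, fun i => ?_⟩
  rw [Module.Basis.mk_apply]
  exact hvh i

/-- The three linear Jacobian syzygies given by the action of `sl₂` on binary cubic forms. -/
noncomputable def deltaSyzygy : Fin 3 → Fin 4 → S :=
  ![![0, 3 * X 0, 2 * X 1, X 2], ![X 1, 2 * X 2, 3 * X 3, 0], ![3 * X 0, X 1, -X 2, -3 * X 3]]

theorem mem_AR_Delta3 {a : Fin 4 → S} : a ∈ AR Delta3 ↔
    a 0 * (-4 * X 2 ^ 3 + 18 * X 1 * X 2 * X 3 - 54 * X 0 * X 3 ^ 2)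
    + a 1 * (2 * X 1 * X 2 ^ 2 - 12 * X 1 ^ 2 * X 3 + 18 * X 0 * X 2 * X 3)
    + a 2 * (2 * X 1 ^ 2 * X 2 - 12 * X 0 * X 2 ^ 2 + 18 * X 0 * X 1 * X 3)
    + a 3 * (-4 * X 1 ^ 3 + 18 * X 0 * X 1 * X 2 - 54 * X 0 ^ 2 * X 3) = 0 := by
  rw [mem_AR]
  have h : ∀ i, pderiv i Delta3 = gradientMap Delta3 i := fun _ => rfl
  simp only [h, gradientMap_Delta3, Matrix.cons_val]

theorem isFreeWithExponents_Delta3 : IsFreeWithExponents Delta3 ![1, 1, 1] := by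
  have hX : ∀ i, (X i : S).IsHomogeneous 1 := isHomogeneous_X ℂ
  have hmem : ∀ i, deltaSyzygy i ∈ AR Delta3 := by
    intro i
    rw [mem_AR_Delta3]
    fin_cases i
    · simp [deltaSyzygy]
      ring
    · simp [deltaSyzygy]
      ring
    · simp [deltaSyzygy]
      ring
  have hhom : ∀ i, IsHomogeneousVec 1 (deltaSyzygy i) := by
    have hc : ∀ n : ℕ, ((n : S)).IsHomogeneous 0 := fun n => by
      simpa using isHomogeneous_C (Fin 4) (n : ℂ)
    intro i j
    fin_cases i <;> fin_cases j
    · exact isHomogeneous_zero _ _ _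
    · exact (hc 3).mul (hX 0)
    · exact (hc 2).mul (hX 1)
    · exact hX 2
    · exact hX 1
    · exact (hc 2).mul (hX 2)
    · exact (hc 3).mul (hX 3)
    · exact isHomogeneous_zero _ _ _
    · exact (hc 3).mul (hX 0)
    · exact hX 1
    · exact (hX 2).neg
    · exact (hc 3).neg.mul (hX 3)
  have hD₃ : pderiv 3 Delta3 = -4 * X 1 ^ 3 + 18 * X 0 * X 1 * X 2 - 54 * X 0 ^ 2 * X 3 := by
    have h : pderiv 3 Delta3 = gradientMap Delta3 3 := rfl
    rw [h, gradientMap_Delta3]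
    rfl
  refine isFreeWithExponents_of_detFour isHomogeneous_Delta3 irreducible_Delta3 ?_ ?_
    deltaSyzygy hmem ?_ (c := 2⁻¹) ?_
  · rw [hD₃]
    rintro ⟨q, hq⟩
    have := congrArg (eval ![0, 1, 0, 0]) hq
    simp [Delta3] at this
  · intro i j _
    fin_cases i <;> fin_cases j <;> rfl
  · intro i
    fin_cases i
    · exact hhom 0
    · exact hhom 1
    · exact hhom 2
  · have h2 : (C (2 : ℂ) : S) = 2 := map_ofNat C 2
    have hdet : detFour X (deltaSyzygy 0) (deltaSyzygy 1) (deltaSyzygy 2) = C 2 * Delta3 := by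
      rw [h2]
      simp [detFour, minorThree, deltaSyzygy, Delta3]
      ring
    rw [hdet, ← mul_assoc, ← C_mul]
    simp

end SurfP3

/-! ### Coincidences in low degrees and separation by generator degrees -/

namespace SurfP3

theorem D'_six_eq : D' 6 = D''' 6 := by
  simp [D', D''']

theorem D_nine_eq : D 9 = D' 9 := by
  simp [D, D']

theorem ProjEquiv.of_eq {f g : S} (h : f = g) : ProjEquiv f g :=
  ⟨1, 1, one_ne_zero, by simp [h, linSubst_one]⟩

/-- A triangular change of coordinates that fixes `x` and `y`. -/
theorem ProjEquiv.of_triangular {f g : S} {p q r s t : ℂ} (hr : r ≠ 0) {c : ℂ} (hc : c ≠ 0)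
    (h : bind₁ ![X 0, X 1, C p * X 0 + C q * X 1 + C r * X 2, C s * X 1 + C t * X 3] f = C c * g)
    (ht : t ≠ 0) : ProjEquiv f g := by
  let A : Matrix (Fin 4) (Fin 4) ℂ := !![1, 0, 0, 0; 0, 1, 0, 0; p, q, r, 0; 0, s, 0, t]
  have hA : A.det ≠ 0 := by
    have : A.det = r * t := by
      simp [A, Matrix.det_succ_row_zero, Fin.sum_univ_succ, Fin.succAbove]
    rw [this]
    exact mul_ne_zero hr ht
  refine ⟨Matrix.GeneralLinearGroup.mkOfDetNeZero A hA, c, hc, ?_⟩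
  rw [← h]
  change bind₁ (fun i => ∑ j, C (A i j) * X j) f = _
  congr 2
  funext i
  fin_cases i <;> simp [A, Fin.sum_univ_four]

/-- For d = 4, 5, 6 the extra monomial is x^4, x^4 y, x^4 y². It is absorbed by z ↦ z - x, z ↦ z -
y, w ↦ w - y respectively. -/
theorem projEquiv_D_four : ProjEquiv (D 4) (D'' 4) :=
  ProjEquiv.of_triangular (p := -1) (q := 0) (r := 1) (s := 0) (t := 1) one_ne_zero
    one_ne_zero (by simp [D, D'']; ring) one_ne_zero

theorem projEquiv_D_five : ProjEquiv (D 5) (D'' 5) :=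
  ProjEquiv.of_triangular (p := 0) (q := -1) (r := 1) (s := 0) (t := 1) one_ne_zero
    one_ne_zero (by simp [D, D'']; ring) one_ne_zero

theorem projEquiv_D_six : ProjEquiv (D 6) (D'' 6) :=
  ProjEquiv.of_triangular (p := 0) (q := 0) (r := 1) (s := -1) (t := 1) one_ne_zero
    one_ne_zero (by simp [D, D'']; ring) one_ne_zero

theorem projEquiv_D_five_D'_five : ProjEquiv (D 5) (D' 5) := by
  have h2 : (C (2⁻¹ : ℂ) : S) * 2 = 1 := by
    have : (2 : S) = C 2 := (map_ofNat C 2).symm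
    rw [this, ← C_mul]
    simp
  -- In `D' 5` the monomial y^5 occurs twice. Removing x^4 y and halving z and w turns `D 5` into
  -- one half of `D' 5`.
  refine ProjEquiv.of_triangular (p := 0) (q := -1) (r := 2⁻¹) (s := 0) (t := 2⁻¹) (by norm_num)
    (c := 2⁻¹) (by norm_num) ?_ (by norm_num)
  simp only [D, D', map_add, map_mul, map_pow, bind₁_X_right, Matrix.cons_val, map_neg, map_one,
    map_zero, Nat.reduceSub]
  linear_combination (-X 1 ^ 5 : S) * h2

/-- The degrees occurring in a minimal system of homogeneous generators of `AR f`. -/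
def HasGeneratorDegrees (f : S) (s : Set ℕ) : Prop :=
  ∃ n, ∃ deg : Fin n → ℕ, HasMinimalGenerators f deg ∧ Set.range deg = s

theorem IsFreeWithExponents.hasGeneratorDegrees {f : S} {a b c : ℕ}
    (h : IsFreeWithExponents f ![a, b, c]) : HasGeneratorDegrees f {a, b, c} :=
  ⟨3, _, h.hasMinimalGenerators, by
    ext k
    simp [eq_comm]
    tauto⟩

theorem IsNearlyFreeWithExponents.hasGeneratorDegrees {f : S} {a b c : ℕ}
    (h : IsNearlyFreeWithExponents f a b c) : HasGeneratorDegrees f {a, b, c} :=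
  ⟨4, _, h.hasMinimalGenerators, by
    ext k
    simp [eq_comm]
    tauto⟩

theorem HasGeneratorDegrees.not_projEquiv {f g : S} {s t : Set ℕ} (hf : HasGeneratorDegrees f s)
    (hg : HasGeneratorDegrees g t) (k : ℕ) (hk : ¬ (k ∈ s ↔ k ∈ t)) : ¬ ProjEquiv f g := by
  obtain ⟨_, deg, h, rfl⟩ := hf
  obtain ⟨_, deg', h', rfl⟩ := hg
  exact not_projEquiv_of_range_ne h h' fun e => hk (by rw [e])

theorem IsFreeWithExponents.isFree {f : S} {e : Fin 3 → ℕ} (h : IsFreeWithExponents f e) :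
    IsFree f :=
  ⟨e, h⟩

theorem IsNearlyFreeWithExponents.isNearlyFree {f : S} {a b c : ℕ}
    (h : IsNearlyFreeWithExponents f a b c) : IsNearlyFree f :=
  ⟨a, b, c, h⟩

theorem isNearlyFreeWithExponents_D_four : IsNearlyFreeWithExponents (D 4) 1 1 2 :=
  (isNearlyFreeWithExponents_D'' 0).of_projEquiv projEquiv_D_four.symm

theorem isNearlyFreeWithExponents_D_five : IsNearlyFreeWithExponents (D 5) 1 1 3 :=
  (isNearlyFreeWithExponents_D'' 1).of_projEquiv projEquiv_D_five.symm

theorem isNearlyFreeWithExponents_D_six : IsNearlyFreeWithExponents (D 6) 1 1 4 :=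
  (isNearlyFreeWithExponents_D'' 2).of_projEquiv projEquiv_D_six.symm

theorem isNearlyFreeWithExponents_D'_six : IsNearlyFreeWithExponents (D' 6) 1 2 3 :=
  D'_six_eq ▸ isNearlyFreeWithExponents_D''' 1

theorem pairwiseInequivalent_pair {f g : S} (h : ¬ ProjEquiv f g) :
    PairwiseInequivalent [f, g] := by
  simpa [PairwiseInequivalent] using h

theorem pairwiseInequivalent_triple {f g h : S} (hfg : ¬ ProjEquiv f g) (hfh : ¬ ProjEquiv f h)
    (hgh : ¬ ProjEquiv g h) : PairwiseInequivalent [f, g, h] := by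
  simp [PairwiseInequivalent, hfg, hfh, hgh]

theorem pairwiseInequivalent_quadruple {f g h k : S} (hfg : ¬ ProjEquiv f g)
    (hfh : ¬ ProjEquiv f h) (hfk : ¬ ProjEquiv f k) (hgh : ¬ ProjEquiv g h)
    (hgk : ¬ ProjEquiv g k) (hhk : ¬ ProjEquiv h k) : PairwiseInequivalent [f, g, h, k] := by
  simp [PairwiseInequivalent, hfg, hfh, hfk, hgh, hgk, hhk]

end SurfP3

theorem corollary4p7 :
    -- degree 4
    ((IsIrreducibleHomaloidal 4 Delta3 ∧ IsFree Delta3) ∧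
      (IsIrreducibleHomaloidal 4 (D 4) ∧ IsNearlyFree (D 4)) ∧
      ProjEquiv (D 4) (D'' 4) ∧
      PairwiseInequivalent [Delta3, D 4]) ∧
    -- degree 5
    ((IsIrreducibleHomaloidal 5 (D 5) ∧ IsNearlyFree (D 5)) ∧
      (IsIrreducibleHomaloidal 5 (D''' 5) ∧ IsNearlyFree (D''' 5)) ∧
      ProjEquiv (D 5) (D' 5) ∧ ProjEquiv (D 5) (D'' 5) ∧
      PairwiseInequivalent [D 5, D''' 5]) ∧
    -- degree 6
    ((IsIrreducibleHomaloidal 6 (D 6) ∧ IsNearlyFree (D 6)) ∧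
      (IsIrreducibleHomaloidal 6 (D' 6) ∧ IsNearlyFree (D' 6)) ∧
      ProjEquiv (D 6) (D'' 6) ∧ ProjEquiv (D' 6) (D''' 6) ∧
      PairwiseInequivalent [D 6, D' 6]) ∧
    -- degrees 7 and 8
    (∀ d : ℕ, d = 7 ∨ d = 8 →
      (IsIrreducibleHomaloidal d (D d) ∧ IsFree (D d)) ∧
      (IsIrreducibleHomaloidal d (D' d) ∧ IsNearlyFree (D' d)) ∧
      (IsIrreducibleHomaloidal d (D'' d) ∧ IsNearlyFree (D'' d)) ∧
      (IsIrreducibleHomaloidal d (D''' d) ∧ IsNearlyFree (D''' d)) ∧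
      PairwiseInequivalent [D d, D' d, D'' d, D''' d]) ∧
    -- degree 9
    ((IsIrreducibleHomaloidal 9 (D 9) ∧ IsNearlyFree (D 9)) ∧
      (IsIrreducibleHomaloidal 9 (D'' 9) ∧ IsNearlyFree (D'' 9)) ∧
      (IsIrreducibleHomaloidal 9 (D''' 9) ∧ IsNearlyFree (D''' 9)) ∧
      ProjEquiv (D 9) (D' 9) ∧
      PairwiseInequivalent [D 9, D'' 9, D''' 9]) ∧
    -- degrees at least 10
    (∀ d : ℕ, 10 ≤ d →
      (IsIrreducibleHomaloidal d (D' d) ∧ IsFree (D' d)) ∧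
      (IsIrreducibleHomaloidal d (D d) ∧ IsNearlyFree (D d)) ∧
      (IsIrreducibleHomaloidal d (D'' d) ∧ IsNearlyFree (D'' d)) ∧
      (IsIrreducibleHomaloidal d (D''' d) ∧ IsNearlyFree (D''' d)) ∧
      PairwiseInequivalent [D' d, D d, D'' d, D''' d]) := by
  refine ⟨?_, ?_, ?_, ?_, ?_, ?_⟩
  · have h := isFreeWithExponents_Delta3
    have h₁ := isNearlyFreeWithExponents_D_four
    exact ⟨⟨isIrreducibleHomaloidal_Delta3, h.isFree⟩,
      ⟨isIrreducibleHomaloidal_D le_rfl, h₁.isNearlyFree⟩, projEquiv_D_four,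
      pairwiseInequivalent_pair <|
        h.hasGeneratorDegrees.not_projEquiv h₁.hasGeneratorDegrees 2 (by simp)⟩
  · have h₁ := isNearlyFreeWithExponents_D_five
    have h₂ : IsNearlyFreeWithExponents (D''' 5) 1 2 2 := isNearlyFreeWithExponents_D''' 0
    exact ⟨⟨isIrreducibleHomaloidal_D (by norm_num), h₁.isNearlyFree⟩,
      ⟨isIrreducibleHomaloidal_D''' (by norm_num), h₂.isNearlyFree⟩,
      projEquiv_D_five_D'_five, projEquiv_D_five,
      pairwiseInequivalent_pair <|
        h₁.hasGeneratorDegrees.not_projEquiv h₂.hasGeneratorDegrees 2 (by simp)⟩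
  · have h₁ := isNearlyFreeWithExponents_D_six
    have h₂ := isNearlyFreeWithExponents_D'_six
    exact ⟨⟨isIrreducibleHomaloidal_D (by norm_num), h₁.isNearlyFree⟩,
      ⟨isIrreducibleHomaloidal_D' (by norm_num), h₂.isNearlyFree⟩,
      projEquiv_D_six, .of_eq D'_six_eq,
      pairwiseInequivalent_pair <|
        h₁.hasGeneratorDegrees.not_projEquiv h₂.hasGeneratorDegrees 2 (by simp)⟩
  · rintro d (rfl | rfl)
    · have h₀ := isFreeWithExponents_D_seven
      have h₁ := isNearlyFreeWithExponents_D'_seven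
      have h₂ : IsNearlyFreeWithExponents (D'' 7) 1 1 5 := isNearlyFreeWithExponents_D'' 3
      have h₃ : IsNearlyFreeWithExponents (D''' 7) 1 2 4 := isNearlyFreeWithExponents_D''' 2
      have g₀ := h₀.hasGeneratorDegrees
      have g₁ := h₁.hasGeneratorDegrees
      have g₂ := h₂.hasGeneratorDegrees
      have g₃ := h₃.hasGeneratorDegrees
      exact ⟨⟨isIrreducibleHomaloidal_D (by norm_num), h₀.isFree⟩,
        ⟨isIrreducibleHomaloidal_D' (by norm_num), h₁.isNearlyFree⟩,
        ⟨isIrreducibleHomaloidal_D'' (by norm_num), h₂.isNearlyFree⟩,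
        ⟨isIrreducibleHomaloidal_D''' (by norm_num), h₃.isNearlyFree⟩,
        pairwiseInequivalent_quadruple (g₀.not_projEquiv g₁ 2 (by simp))
          (g₀.not_projEquiv g₂ 2 (by simp)) (g₀.not_projEquiv g₃ 3 (by simp))
          (g₁.not_projEquiv g₂ 3 (by simp)) (g₁.not_projEquiv g₃ 2 (by simp))
          (g₂.not_projEquiv g₃ 2 (by simp))⟩
    · have h₀ := isFreeWithExponents_D_eight
      have h₁ := isNearlyFreeWithExponents_D'_eight
      have h₂ : IsNearlyFreeWithExponents (D'' 8) 1 1 6 := isNearlyFreeWithExponents_D'' 4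
      have h₃ : IsNearlyFreeWithExponents (D''' 8) 1 2 5 := isNearlyFreeWithExponents_D''' 3
      have g₀ := h₀.hasGeneratorDegrees
      have g₁ := h₁.hasGeneratorDegrees
      have g₂ := h₂.hasGeneratorDegrees
      have g₃ := h₃.hasGeneratorDegrees
      exact ⟨⟨isIrreducibleHomaloidal_D (by norm_num), h₀.isFree⟩,
        ⟨isIrreducibleHomaloidal_D' (by norm_num), h₁.isNearlyFree⟩,
        ⟨isIrreducibleHomaloidal_D'' (by norm_num), h₂.isNearlyFree⟩,
        ⟨isIrreducibleHomaloidal_D''' (by norm_num), h₃.isNearlyFree⟩,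
        pairwiseInequivalent_quadruple (g₀.not_projEquiv g₁ 4 (by simp))
          (g₀.not_projEquiv g₂ 3 (by simp)) (g₀.not_projEquiv g₃ 2 (by simp))
          (g₁.not_projEquiv g₂ 3 (by simp)) (g₁.not_projEquiv g₃ 2 (by simp))
          (g₂.not_projEquiv g₃ 2 (by simp))⟩
  · have h₁ := isNearlyFreeWithExponents_D_nine
    have h₂ : IsNearlyFreeWithExponents (D'' 9) 1 1 7 := isNearlyFreeWithExponents_D'' 5
    have h₃ : IsNearlyFreeWithExponents (D''' 9) 1 2 6 := isNearlyFreeWithExponents_D''' 4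
    have g₁ := h₁.hasGeneratorDegrees
    have g₂ := h₂.hasGeneratorDegrees
    have g₃ := h₃.hasGeneratorDegrees
    exact ⟨⟨isIrreducibleHomaloidal_D (by norm_num), h₁.isNearlyFree⟩,
      ⟨isIrreducibleHomaloidal_D'' (by norm_num), h₂.isNearlyFree⟩,
      ⟨isIrreducibleHomaloidal_D''' (by norm_num), h₃.isNearlyFree⟩,
      .of_eq D_nine_eq,
      pairwiseInequivalent_triple (g₁.not_projEquiv g₂ 4 (by simp))
        (g₁.not_projEquiv g₃ 2 (by simp)) (g₂.not_projEquiv g₃ 2 (by simp))⟩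
  · intro d hd
    obtain ⟨j, rfl⟩ := Nat.exists_eq_add_of_le' hd
    have h₀ := isFreeWithExponents_D' j
    have h₂ : IsNearlyFreeWithExponents (D'' (j + 10)) 1 1 (j + 8) :=
      isNearlyFreeWithExponents_D'' (j + 6)
    have h₃ : IsNearlyFreeWithExponents (D''' (j + 10)) 1 2 (j + 7) :=
      isNearlyFreeWithExponents_D''' (j + 5)
    -- For `D` one has k = 4 and m = d - 5, so d = 10 is the case k = m - 1, while d ≥ 11 falls
    -- under k ≤ m - 2.
    have h₁ : IsNearlyFreeWithExponents (D (j + 10)) 1 (if j = 0 then 4 else 5)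
        (if j = 0 then 5 else j + 4) := by
      obtain rfl | ⟨ν, rfl⟩ : j = 0 ∨ ∃ ν, j = ν + 1 := by
        cases j <;> simp
      · exact isNearlyFreeWithExponents_D_ten
      · have e : ν + 1 + 4 = ν + 5 := by omega
        simp only [Nat.add_eq_zero_iff, one_ne_zero, and_false, if_false, e]
        exact isNearlyFreeWithExponents_D ν
    have g₀ := h₀.hasGeneratorDegrees
    have g₁ := h₁.hasGeneratorDegrees
    have g₂ := h₂.hasGeneratorDegrees
    have g₃ := h₃.hasGeneratorDegrees
    have m₁ : ∀ k, k ∈ ({1, if j = 0 then 4 else 5, if j = 0 then 5 else j + 4} : Set ℕ) ↔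
        k = 1 ∨ k = 5 ∨ (j = 0 ∧ k = 4) ∨ (j ≠ 0 ∧ k = j + 4) := by
      intro k
      by_cases hj : j = 0 <;> simp [hj]
      tauto
    refine ⟨⟨isIrreducibleHomaloidal_D' (by omega), h₀.isFree⟩,
      ⟨isIrreducibleHomaloidal_D (by omega), h₁.isNearlyFree⟩,
      ⟨isIrreducibleHomaloidal_D'' (by omega), h₂.isNearlyFree⟩,
      ⟨isIrreducibleHomaloidal_D''' (by omega), h₃.isNearlyFree⟩,
      pairwiseInequivalent_quadruple
        -- The generator degrees are {1, 4, j+4} for `D'`, against {1, 4, 5} for `D` if j = 0 and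
        -- {1, 5, j+4} otherwise.
        (g₀.not_projEquiv g₁ (if j = 0 then 5 else 4) ?_)
        (g₀.not_projEquiv g₂ 4 ?_) (g₀.not_projEquiv g₃ 2 ?_)
        (g₁.not_projEquiv g₂ 5 ?_) (g₁.not_projEquiv g₃ 2 ?_)
        (g₂.not_projEquiv g₃ 2 ?_)⟩
    · by_cases hj : j = 0
      · simp [hj]
      · rw [m₁]
        simp [hj]
    · simp
    · simp
    · rw [m₁]
      simp
    · rw [m₁]
      simp
    · simp
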